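/- A Buffon machine is a deterministic computable device (equivalently, a Turing machine or a register machine) that can, at any time, call for the next of a sequence of independent fair coin flips or for the next of a sequence of independent Bernoulli input bits, the latter of unknown parameter $x$ and independent of the flips, and that can halt and output a bit. A function $\phi:(0,1)\to(0,1)$ admits a strong simulation if there is a single Buffon machine, not depending on $x$, such that, for every $x\in(0,1)$, when the input bits have parameter $x$ the machine halts with probability $1$, outputs $1$ with probability exactly $\phi(x)$, and uses a total number $C$ of random bits (fair flips and input bits together) that has exponential tails: there are constants $K$ and $\rho\in[0,1)$, which may depend on $x$, such that $\mathbb{P}(C>m)\le K\rho^{m}$ for all integers $m\ge 0$. Theorem. Each of the following functions of $x\in(0,1)$ takes its values in $(0,1)$ and admits a strong simulation: \[ \begin{array}{l} e^{-x},\quad e^{x-1},\quad (1-x)e^{x},\quad x e^{1-x},\\[1mm] \dfrac{x}{\log\frac{1}{1-x}},\quad \dfrac{1-x}{\log\frac1x},\quad (1-x)\log\dfrac{1}{1-x},\quad x\log\dfrac1x,\\[3mm] \cos x,\quad \dfrac{1-x}{\cos x},\quad \dfrac{x}{\tan x},\quad (1-x)\tan x. \end{array} \] -/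

import Mathlib

open MeasureTheory ProbabilityTheory

/-- The instructions of a Buffon machine: halt and output a bit, make a step of pure computation,
flip the machine's own fair coin, or draw the next bit from the input. -/
inductive BuffonInstr
  | halt (b : Bool)
  | compute
  | flip
  | input

/-- Numbering of the five instructions. -/
def BuffonInstr.equivFin : BuffonInstr ≃ Fin 5 where
  toFun
    | .halt false => 0
    | .halt true => 1
    | .compute => 2
    | .flip => 3
    | .input => 4
  invFun
    | 0 => .halt false
    | 1 => .halt true
    | 2 => .compute
    | 3 => .flip
    | 4 => .input
  left_inv := by rintro ((_ | _) | _ | _ | _) <;> rfl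
  right_inv := by intro i; fin_cases i <;> rfl

instance : Primcodable BuffonInstr := Primcodable.ofEquiv (Fin 5) BuffonInstr.equivFin

/-- A Buffon machine with one input and one output bit: a deterministic device whose states are
finite (integer-codable) data and which passes from state to state by a computable rule, with
access to a source of fair coin flips and to a source of input bits.
`instr s` is the instruction carried out in state `s`, and `next s b` is the following state when
the instruction has obtained the bit `b` (for a step of pure computation, which obtains no bit,
`b` is `false`). The rule is computable in the sense of Turing machines or register machines, and
any such machine is of this form, its configurations being the states. -/
structure BuffonMachine where
  State : Type
  [primcodable : Primcodable State]
  start : State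
  instr : State → BuffonInstr
  next : State → Bool → State
  computable_instr : Computable instr
  computable_next : Computable₂ next

namespace BuffonMachine

/-- A configuration of a computation: the state, and how many fair flips and how many input bits
have been used. -/
@[ext]
structure Config (M : BuffonMachine) where
  state : M.State
  flips : ℕ
  inputs : ℕ

variable (M : BuffonMachine)

/-- One step of the computation. The first component of `ω` is the sequence of fair flips, the
second one the sequence of input bits; each bit is used at most once, in order. -/
def step (ω : (ℕ → Bool) × (ℕ → Bool)) (c : M.Config) : M.Config :=
  match M.instr c.state with
  | .halt _ => c
  | .compute => ⟨M.next c.state false, c.flips, c.inputs⟩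
  | .flip => ⟨M.next c.state (ω.1 c.flips), c.flips + 1, c.inputs⟩
  | .input => ⟨M.next c.state (ω.2 c.inputs), c.flips, c.inputs + 1⟩

/-- The configuration after `n` steps (a machine that has halted stays as it is). -/
def run (ω : (ℕ → Bool) × (ℕ → Bool)) (n : ℕ) : M.Config :=
  (M.step ω)^[n] ⟨M.start, 0, 0⟩

/-- The machine halts, with the output bit `b`. -/
def Outputs (ω : (ℕ → Bool) × (ℕ → Bool)) (b : Bool) : Prop :=
  ∃ n, M.instr (M.run ω n).state = .halt b

/-- The cost of the computation: the total number of random bits (fair flips and input bits) that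
are used. -/
noncomputable def cost (ω : (ℕ → Bool) × (ℕ → Bool)) : ℕ∞ :=
  ⨆ n, (((M.run ω n).flips + (M.run ω n).inputs : ℕ) : ℕ∞)

end BuffonMachine

/-- A sequence of independent bits, each equal to `true` with probability `p`. -/
noncomputable def bernoulliStream (p : unitInterval) : Measure (ℕ → Bool) :=
  Measure.infinitePi fun _ => bernoulliMeasure true false p

/-- The randomness available to a machine: an infinite sequence of fair flips and, independent of
it, an infinite sequence of independent input bits of parameter `p`. -/
noncomputable def buffonSource (p : unitInterval) : Measure ((ℕ → Bool) × (ℕ → Bool)) :=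
  (bernoulliStream ⟨1 / 2, by norm_num, by norm_num⟩).prod (bernoulliStream p)

/-- The machine `M` realizes `φ` strongly: for every input parameter `p` in `(0, 1)`, it halts
with probability `1`, its output is Bernoulli of parameter `φ p`, and its cost has exponential
tails. The machine does not depend on `p`; the constants of the tail bound may. -/
def BuffonMachine.StronglyRealizes (M : BuffonMachine) (φ : ℝ → ℝ) : Prop :=
  ∀ p : unitInterval, 0 < p → p < 1 →
    (∀ᵐ ω ∂buffonSource p, ∃ b, M.Outputs ω b) ∧
    (buffonSource p).real {ω | M.Outputs ω true} = φ p ∧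
    ∃ K ρ : ℝ, 0 ≤ ρ ∧ ρ < 1 ∧
      ∀ m : ℕ, (buffonSource p).real {ω | (m : ℕ∞) < M.cost ω} ≤ K * ρ ^ m

/-- A function on `(0, 1)` with values in `(0, 1)` is strongly realizable (has a strong
simulation) if some Buffon machine realizes it strongly. Values of `φ` outside `(0, 1)` play no
role. -/
def StronglyRealizable (φ : ℝ → ℝ) : Prop :=
  (∀ x ∈ Set.Ioo (0 : ℝ) 1, φ x ∈ Set.Ioo (0 : ℝ) 1) ∧
    ∃ M : BuffonMachine, M.StronglyRealizes φ

/-! Let y be x or 1 - x, and let A(y) = ∑ a_n y^n have rational coefficients in [0, 1] whose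
numerators and denominators are computable. Counting input bits of one kind until the other appears
gives N with P(N = n) = (1 - y) y^n. Accepting N = n with probability a_n makes the acceptance
probability (1 - y) A(y). If a_k = 1 and rounds are repeated until one is accepted, the accepted N
equals k with probability y^k / A(y). The twelve functions have one of these two forms, with A among
exp, log(1/(1 - y)), 1/cos and tan, and k = 0 or 1. A rational probability a_n is simulated exactly
by comparing fair flips with its binary digits, in integer arithmetic.

Correctness is a Markov chain argument (`stronglyRealizes_of_harmonic`). The candidate output
probability, as a function of the state, is harmonic and has the right values at halting states. So
it differs from the probability of having output `true` by time n by at most the probability of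
still running. A halting state is always within a bounded number of bits, so the latter decays
geometrically; since each step uses at most one bit, this also bounds the cost.

For 1/cos and tan the coefficients come from f = 1/cos + tan, which solves 2f' = 1 + f², f(0) = 1.
The resulting recursion shows that they are computable and lie in [0, 1]; even and odd parts
separate the two functions. -/

/-! ### The bit source and conditioning on its first bit -/

/-- Prepend a bit to a sequence. -/
def consBit (b : Bool) (η : ℕ → Bool) : ℕ → Bool
  | 0 => b
  | n + 1 => η n

lemma measurable_consBit (b : Bool) : Measurable (consBit b) := by
  refine measurable_pi_lambda _ fun n => ?_
  cases n with
  | zero => exact measurable_const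
  | succ n => exact measurable_pi_apply n

instance (p : unitInterval) : IsProbabilityMeasure (bernoulliStream p) := by
  unfold bernoulliStream; infer_instance

lemma consBit_preimage_pi (b : Bool) (s : Finset ℕ) (t : ℕ → Set Bool) :
    consBit b ⁻¹' (Set.pi s t) =
      {_η | 0 ∈ s → b ∈ t 0} ∩
        Set.pi (s.preimage Nat.succ Nat.succ_injective.injOn : Finset ℕ) (fun n => t (n + 1)) := by
  ext η
  simp only [Set.mem_preimage, Set.mem_pi, Finset.mem_coe, Set.mem_inter_iff, Set.mem_ofPred_eq,
    Finset.mem_preimage, Nat.succ_eq_add_one]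
  constructor
  · intro h
    exact ⟨fun h0 => h 0 h0, fun n hn => h (n + 1) hn⟩
  · rintro ⟨h0, h1⟩ (_ | n) hn
    · exact h0 hn
    · exact h1 n hn

/-- A product measure is determined by finite boxes. Pulling a box back along `consBit b` leaves a
condition on `b` and a shifted box, so the mixture over `b` restores the missing factor at
coordinate 0. -/
lemma bernoulliStream_eq (p : unitInterval) :
    bernoulliStream p =
      ENNReal.ofReal p • (bernoulliStream p).map (consBit true) +
        ENNReal.ofReal (1 - p) • (bernoulliStream p).map (consBit false) := by
  classical
  symm
  conv_rhs => rw [bernoulliStream]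
  refine Measure.eq_infinitePi _ fun s t ht => ?_
  have hpi : ∀ (s : Finset ℕ) (t : ℕ → Set Bool), MeasurableSet (Set.pi (s : Set ℕ) t) := fun s t =>
    MeasurableSet.pi s.countable_toSet fun i _ => MeasurableSet.of_discrete
  have key : ∀ b, (bernoulliStream p).map (consBit b) (Set.pi s t) =
      if 0 ∈ s → b ∈ t 0 then
        ∏ n ∈ s.preimage Nat.succ Nat.succ_injective.injOn,
          bernoulliMeasure true false p (t (n + 1)) else 0 := by
    intro b
    rw [Measure.map_apply (measurable_consBit b) (hpi s t), consBit_preimage_pi]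
    split_ifs with h
    · rw [show {_η : ℕ → Bool | 0 ∈ s → b ∈ t 0} = Set.univ from Set.eq_univ_of_forall fun _ => h,
        Set.univ_inter, bernoulliStream, Measure.infinitePi_pi _ fun i _ => MeasurableSet.of_discrete]
    · rw [show {_η : ℕ → Bool | 0 ∈ s → b ∈ t 0} = ∅ from Set.eq_empty_of_forall_notMem fun _ => h]
      simp
  have hber : ∀ A : Set Bool, bernoulliMeasure true false p A =
      (ENNReal.ofReal p * if true ∈ A then 1 else 0) +
        ENNReal.ofReal (1 - p) * if false ∈ A then 1 else 0 := by
    intro A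
    have h1 : ENNReal.ofReal (p : ℝ) = (unitInterval.toNNReal p : ENNReal) := by
      rw [ENNReal.ofReal, ENNReal.coe_inj]; ext; simp [unitInterval.toNNReal, p.2.1]; rfl
    have h2 : ENNReal.ofReal (1 - p : ℝ) = (unitInterval.toNNReal (unitInterval.symm p) : ENNReal) := by
      rw [ENNReal.ofReal, ENNReal.coe_inj]; ext; simp [unitInterval.toNNReal, p.2.2]; rfl
    rw [bernoulliMeasure_def, h1, h2]
    by_cases ht : true ∈ A <;> by_cases hf : false ∈ A <;> simp [ht, hf]
  rw [Measure.add_apply, Measure.smul_apply, Measure.smul_apply, key, key]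
  have himg : ∏ n ∈ s.preimage Nat.succ Nat.succ_injective.injOn,
      bernoulliMeasure true false p (t (n + 1)) =
      ∏ n ∈ s.erase 0, bernoulliMeasure true false p (t n) := by
    refine Finset.prod_bij (fun n _ => n + 1) ?_ ?_ ?_ ?_
    · intro a ha; simpa using ha
    · intro a _ b _ h; simpa using h
    · intro b hb
      obtain ⟨hb0, hb⟩ := Finset.mem_erase.1 hb
      exact ⟨b - 1, by simpa [Nat.sub_add_cancel (Nat.pos_of_ne_zero hb0)] using hb,
        Nat.sub_add_cancel (Nat.pos_of_ne_zero hb0)⟩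
    · intro a _; rfl
  rw [himg]
  set c := ∏ n ∈ s.erase 0, bernoulliMeasure true false p (t n)
  by_cases h0 : 0 ∈ s
  · rw [← Finset.mul_prod_erase s _ h0, hber (t 0)]
    by_cases ht : true ∈ t 0 <;> by_cases hf : false ∈ t 0 <;> simp [h0, ht, hf, c, add_mul]
  · have : c = ∏ n ∈ s, bernoulliMeasure true false p (t n) := by
      simp [c, Finset.erase_eq_of_notMem h0]
    simp only [h0, false_imp_iff, if_true, smul_eq_mul, ← add_mul]
    rw [← ENNReal.ofReal_add p.2.1 (sub_nonneg.2 p.2.2), this]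
    simp

/-- The parameter of a fair coin. -/
noncomputable def fairBit : unitInterval := ⟨1 / 2, by norm_num, by norm_num⟩

lemma buffonSource_eq (p : unitInterval) :
    buffonSource p = (bernoulliStream fairBit).prod (bernoulliStream p) := rfl

instance (p : unitInterval) : IsProbabilityMeasure (buffonSource p) := by
  unfold buffonSource; infer_instance

/-- Conditioning on the first fair flip. -/
lemma buffonSource_real_flip (p : unitInterval) {E : Set ((ℕ → Bool) × (ℕ → Bool))}
    (hE : MeasurableSet E) :
    (buffonSource p).real E =
      1 / 2 * (buffonSource p).real (Prod.map (consBit true) id ⁻¹' E) +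
        1 / 2 * (buffonSource p).real (Prod.map (consBit false) id ⁻¹' E) := by
  have hm : ∀ b, Measurable (Prod.map (consBit b) (id : (ℕ → Bool) → (ℕ → Bool))) := fun b =>
    (measurable_consBit b).prodMap measurable_id
  conv_lhs => rw [buffonSource_eq, bernoulliStream_eq fairBit]
  have hid : bernoulliStream p = (bernoulliStream p).map id := Measure.map_id.symm
  have hmap : ∀ b, ((bernoulliStream fairBit).map (consBit b)).prod
      (bernoulliStream p) = (buffonSource p).map (Prod.map (consBit b) id) := by
    intro b
    conv_lhs => rw [hid]
    rw [Measure.map_prod_map _ _ (measurable_consBit b) measurable_id, buffonSource_eq]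
  rw [Measure.add_prod, Measure.prod_smul_left, Measure.prod_smul_left, hmap, hmap, measureReal_def,
    Measure.add_apply, Measure.smul_apply, Measure.smul_apply, Measure.map_apply (hm _) hE,
    Measure.map_apply (hm _) hE, smul_eq_mul, smul_eq_mul, ENNReal.toReal_add (by finiteness)
    (by finiteness), ENNReal.toReal_mul, ENNReal.toReal_mul, 
    ENNReal.toReal_ofReal fairBit.2.1, ENNReal.toReal_ofReal (sub_nonneg.2 fairBit.2.2)]
  norm_num [measureReal_def, fairBit]

/-- Conditioning on the first input bit. -/
lemma buffonSource_real_input (p : unitInterval) {E : Set ((ℕ → Bool) × (ℕ → Bool))}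
    (hE : MeasurableSet E) :
    (buffonSource p).real E =
      p * (buffonSource p).real (Prod.map id (consBit true) ⁻¹' E) +
        (1 - p) * (buffonSource p).real (Prod.map id (consBit false) ⁻¹' E) := by
  have hm : ∀ b, Measurable (Prod.map (id : (ℕ → Bool) → (ℕ → Bool)) (consBit b)) := fun b =>
    measurable_id.prodMap (measurable_consBit b)
  conv_lhs => rw [buffonSource_eq, bernoulliStream_eq p]
  have hmap : ∀ b, (bernoulliStream fairBit).prod
      ((bernoulliStream p).map (consBit b)) = (buffonSource p).map (Prod.map id (consBit b)) := by
    intro b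
    rw [buffonSource_eq, ← Measure.map_prod_map _ _ measurable_id (measurable_consBit b),
      Measure.map_id]
  rw [Measure.prod_add, Measure.prod_smul_right, Measure.prod_smul_right, hmap, hmap,
    measureReal_def,
    Measure.add_apply, Measure.smul_apply, Measure.smul_apply, Measure.map_apply (hm _) hE,
    Measure.map_apply (hm _) hE, smul_eq_mul, smul_eq_mul, ENNReal.toReal_add (by finiteness)
    (by finiteness), ENNReal.toReal_mul, ENNReal.toReal_mul, ENNReal.toReal_ofReal p.2.1,
    ENNReal.toReal_ofReal (sub_nonneg.2 p.2.2)]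
  rfl

/-! ### A machine as a Markov chain on its states -/

namespace BuffonMachine

variable (M : BuffonMachine)

/-- The transition operator of the Markov chain of states, for inputs of parameter `p`. -/
noncomputable def avg (p : ℝ) (g : M.State → ℝ) (s : M.State) : ℝ :=
  match M.instr s with
  | .halt _ => g s
  | .compute => g (M.next s false)
  | .flip => 1 / 2 * g (M.next s true) + 1 / 2 * g (M.next s false)
  | .input => p * g (M.next s true) + (1 - p) * g (M.next s false)

/-- The state reached after `n` steps from the state `s`. -/
def stateAfter (ω : (ℕ → Bool) × (ℕ → Bool)) (n : ℕ) (s : M.State) : M.State :=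
  ((M.step ω)^[n] ⟨s, 0, 0⟩).state

/-- The state is a halting state. -/
def Halted (s : M.State) : Prop := ∃ b, M.instr s = .halt b

/-- Some sequence of at most `n` random bits leads from the state to a halting state. -/
def HaltsWithin : ℕ → M.State → Prop
  | 0, s => M.Halted s
  | n + 1, s => M.Halted s ∨
      ((M.instr s = .flip ∨ M.instr s = .input) ∧ ∃ b, HaltsWithin n (M.next s b))

lemma HaltsWithin.mono {n : ℕ} {s : M.State} (h : M.HaltsWithin n s) {m : ℕ} (hm : n ≤ m) :
    M.HaltsWithin m s := by
  induction n generalizing s m with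
  | zero =>
    cases m with
    | zero => exact h
    | succ m => exact Or.inl h
  | succ n ih =>
    obtain ⟨m, rfl⟩ : ∃ k, m = k + 1 := ⟨m - 1, by omega⟩
    rcases h with h | ⟨h, b, hb⟩
    · exact Or.inl h
    · exact Or.inr ⟨h, b, ih hb (by omega)⟩

/-- Advancing the flip counter while prepending a flip conjugates one step into the other. So after
the first bit is used, the run restarts on the remaining stream. -/
lemma stateAfter_consBit_flip (b : Bool) (ω : (ℕ → Bool) × (ℕ → Bool)) (n : ℕ) (s : M.State) :
    ((M.step (Prod.map (consBit b) id ω))^[n] ⟨s, 1, 0⟩).state = M.stateAfter ω n s := by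
  have h : Function.Semiconj (fun c : M.Config => (⟨c.state, c.flips + 1, c.inputs⟩ : M.Config))
      (M.step ω) (M.step (Prod.map (consBit b) id ω)) := by
    intro c
    unfold step
    dsimp only
    cases M.instr c.state <;> simp [consBit]
  simpa [stateAfter] using congrArg Config.state ((h.iterate_right n).eq ⟨s, 0, 0⟩).symm

lemma stateAfter_consBit_input (b : Bool) (ω : (ℕ → Bool) × (ℕ → Bool)) (n : ℕ) (s : M.State) :
    ((M.step (Prod.map id (consBit b) ω))^[n] ⟨s, 0, 1⟩).state = M.stateAfter ω n s := by
  have h : Function.Semiconj (fun c : M.Config => (⟨c.state, c.flips, c.inputs + 1⟩ : M.Config))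
      (M.step ω) (M.step (Prod.map id (consBit b) ω)) := by
    intro c
    unfold step
    dsimp only
    cases M.instr c.state <;> simp [consBit]
  simpa [stateAfter] using congrArg Config.state ((h.iterate_right n).eq ⟨s, 0, 0⟩).symm

/-- A step reads at most one coordinate of the source, so the event splits into two pieces according
to that bit. No measurable structure on the states is involved. -/
lemma measurableSet_iterate_step (n : ℕ) (c : M.Config) (A : Set M.State) :
    MeasurableSet {ω | ((M.step ω)^[n] c).state ∈ A} := by
  induction n generalizing c with
  | zero => exact MeasurableSet.const (c.state ∈ A)
  | succ n ih =>
    simp only [Function.iterate_succ_apply]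
    have hsplit : ∀ (f : (ℕ → Bool) × (ℕ → Bool) → Bool) (_ : Measurable f) (d : Bool → M.Config),
        MeasurableSet {ω | ((M.step ω)^[n] (d (f ω))).state ∈ A} := by
      intro f hf d
      have : {ω | ((M.step ω)^[n] (d (f ω))).state ∈ A} =
          ⋃ b, f ⁻¹' {b} ∩ {ω | ((M.step ω)^[n] (d b)).state ∈ A} := by
        ext ω; simp
      rw [this]
      exact MeasurableSet.iUnion fun b => (hf (measurableSet_singleton b)).inter (ih _)
    unfold step
    cases M.instr c.state with
    | halt b => exact ih c
    | compute => exact ih _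
    | flip =>
      exact hsplit (fun ω => ω.1 c.flips) (by fun_prop)
        fun b => ⟨M.next c.state b, c.flips + 1, c.inputs⟩
    | input =>
      exact hsplit (fun ω => ω.2 c.inputs) (by fun_prop)
        fun b => ⟨M.next c.state b, c.flips, c.inputs + 1⟩

lemma measurableSet_stateAfter (n : ℕ) (s : M.State) (A : Set M.State) :
    MeasurableSet {ω | M.stateAfter ω n s ∈ A} :=
  M.measurableSet_iterate_step n _ A

/-- The distribution of the state after `n` steps is given by the transition operator. -/
lemma measureReal_stateAfter (p : unitInterval) (n : ℕ) (s : M.State) (A : Set M.State) :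
    (buffonSource p).real {ω | M.stateAfter ω n s ∈ A} =
      (M.avg p)^[n] (A.indicator 1) s := by
  induction n generalizing s with
  | zero =>
    by_cases h : s ∈ A <;> simp [stateAfter, h]
  | succ n ih =>
    -- The outermost `avg` averages over the first move of the run; the inner iterate handles the
    -- remaining `n` steps.
    rw [Function.iterate_succ_apply']
    set g := (M.avg p)^[n] (A.indicator 1)
    unfold avg
    cases hs : M.instr s with
    | halt b =>
      have : ∀ ω, M.stateAfter ω (n + 1) s = M.stateAfter ω n s := fun ω => by
        simp [stateAfter, step, hs]
      simp only [this, ih]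
    | compute =>
      have : ∀ ω, M.stateAfter ω (n + 1) s = M.stateAfter ω n (M.next s false) := fun ω => by
        simp [stateAfter, step, hs]
      simp only [this, ih]
    | flip =>
      have : ∀ b ω, M.stateAfter (Prod.map (consBit b) id ω) (n + 1) s =
          M.stateAfter ω n (M.next s b) := fun b ω => by
        rw [← M.stateAfter_consBit_flip b ω n]
        simp [stateAfter, step, hs, consBit]
      rw [buffonSource_real_flip p (M.measurableSet_stateAfter (n + 1) s A)]
      simp only [Set.preimage_ofPred_eq, this, ih]
    | input =>
      have : ∀ b ω, M.stateAfter (Prod.map id (consBit b) ω) (n + 1) s =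
          M.stateAfter ω n (M.next s b) := fun b ω => by
        rw [← M.stateAfter_consBit_input b ω n]
        simp [stateAfter, step, hs, consBit]
      rw [buffonSource_real_input p (M.measurableSet_stateAfter (n + 1) s A)]
      simp only [Set.preimage_ofPred_eq, this, ih]

/-! ### The transition operator and geometric decay of the running probability -/

section Operator

variable {M} {p : ℝ}

lemma avg_of_halted {s : M.State} (hs : M.Halted s) (g : M.State → ℝ) : M.avg p g s = g s := by
  obtain ⟨b, hb⟩ := hs
  simp [avg, hb]

lemma avg_iterate_of_halted {s : M.State} (hs : M.Halted s) (g : M.State → ℝ) (n : ℕ) :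
    (M.avg p)^[n] g s = g s := by
  induction n with
  | zero => rfl
  | succ n ih => rw [Function.iterate_succ_apply', avg_of_halted hs, ih]

/-- Averaging at a state of the closed set `I` only reads values on `I`, so comparison is required
only there. -/
lemma avg_mono (hp0 : 0 ≤ p) (hp1 : p ≤ 1) {I : Set M.State}
    (hI : ∀ s ∈ I, ∀ b, M.next s b ∈ I) {g g' : M.State → ℝ} (h : ∀ s ∈ I, g s ≤ g' s)
    {s : M.State} (hs : s ∈ I) : M.avg p g s ≤ M.avg p g' s := by
  have ht := h _ (hI s hs true)
  have hf := h _ (hI s hs false)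
  have hp1' : 0 ≤ 1 - p := sub_nonneg.2 hp1
  unfold avg
  cases M.instr s with
  | halt b => exact h s hs
  | compute => exact hf
  | flip => dsimp only; gcongr
  | input => dsimp only; gcongr

lemma avg_iterate_mono (hp0 : 0 ≤ p) (hp1 : p ≤ 1) {I : Set M.State}
    (hI : ∀ s ∈ I, ∀ b, M.next s b ∈ I) {g g' : M.State → ℝ} (h : ∀ s ∈ I, g s ≤ g' s)
    (n : ℕ) {s : M.State} (hs : s ∈ I) : (M.avg p)^[n] g s ≤ (M.avg p)^[n] g' s := by
  induction n generalizing s with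
  | zero => exact h s hs
  | succ n ih =>
    rw [Function.iterate_succ_apply', Function.iterate_succ_apply']
    exact avg_mono hp0 hp1 hI (fun s hs => ih hs) hs

lemma avg_add (g g' : M.State → ℝ) : M.avg p (g + g') = M.avg p g + M.avg p g' := by
  funext s
  simp only [avg, Pi.add_apply]
  cases M.instr s <;> dsimp only <;> ring

lemma avg_iterate_add (g g' : M.State → ℝ) (n : ℕ) :
    (M.avg p)^[n] (g + g') = (M.avg p)^[n] g + (M.avg p)^[n] g' := by
  induction n with
  | zero => rfl
  | succ n ih => simp only [Function.iterate_succ_apply', ih, avg_add]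

lemma avg_smul (c : ℝ) (g : M.State → ℝ) : M.avg p (c • g) = c • M.avg p g := by
  funext s
  simp only [avg, Pi.smul_apply, smul_eq_mul]
  cases M.instr s <;> dsimp only <;> ring

lemma avg_iterate_smul (c : ℝ) (g : M.State → ℝ) (n : ℕ) :
    (M.avg p)^[n] (c • g) = c • (M.avg p)^[n] g := by
  induction n with
  | zero => rfl
  | succ n ih => simp only [Function.iterate_succ_apply', ih, avg_smul]

lemma avg_iterate_eq_self {I : Set M.State} (hI : ∀ s ∈ I, ∀ b, M.next s b ∈ I)
    {g : M.State → ℝ} (h : ∀ s ∈ I, M.avg p g s = g s) (n : ℕ) {s : M.State} (hs : s ∈ I) :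
    (M.avg p)^[n] g s = g s := by
  induction n generalizing s with
  | zero => rfl
  | succ n ih =>
    rw [Function.iterate_succ_apply', ← h s hs]
    have ht := ih (hI s hs true)
    have hf := ih (hI s hs false)
    simp only [avg, ht, hf, ih hs]

variable (M) in
/-- The indicator function of the states that are not halting. -/
noncomputable def running : M.State → ℝ := {s | ¬ M.Halted s}.indicator 1

lemma running_of_halted {s : M.State} (hs : M.Halted s) : M.running s = 0 := by
  simp [running, hs]

lemma running_of_not_halted {s : M.State} (hs : ¬ M.Halted s) : M.running s = 1 := by
  simp [running, hs]

lemma running_le_one (s : M.State) : M.running s ≤ 1 := by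
  by_cases hs : M.Halted s <;> simp [running, hs]

lemma avg_one : M.avg p 1 = 1 := by
  funext s
  simp only [avg, Pi.one_apply]
  cases M.instr s <;> dsimp only <;> ring

lemma avg_iterate_running_le_one (hp0 : 0 ≤ p) (hp1 : p ≤ 1) (n : ℕ) (s : M.State) :
    (M.avg p)^[n] M.running s ≤ 1 := by
  have h1 : (M.avg p)^[n] (1 : M.State → ℝ) = 1 := Function.iterate_fixed avg_one n
  calc (M.avg p)^[n] M.running s ≤ (M.avg p)^[n] 1 s :=
        avg_iterate_mono hp0 hp1 (I := Set.univ) (fun _ _ _ => Set.mem_univ _)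
          (fun s _ => running_le_one s) n (Set.mem_univ s)
    _ = 1 := by rw [h1]; rfl

/-- Halting states are absorbing, so `running` is superharmonic. -/
lemma avg_iterate_running_antitone (hp0 : 0 ≤ p) (hp1 : p ≤ 1) (s : M.State) :
    Antitone fun n => (M.avg p)^[n] M.running s := by
  refine antitone_nat_of_succ_le fun n => ?_
  rw [Function.iterate_succ_apply]
  refine avg_iterate_mono hp0 hp1 (I := Set.univ) (fun _ _ _ => Set.mem_univ _) ?_ n
    (Set.mem_univ s)
  intro s _
  by_cases hs : M.Halted s
  · rw [avg_of_halted hs]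
  · rw [running_of_not_halted hs]
    exact avg_iterate_running_le_one hp0 hp1 1 s

/-- Each bit of a word leading to a halt has probability at least `q`, whether it is a flip or an
input bit. -/
lemma HaltsWithin.avg_iterate_running_le (hp0 : 0 ≤ p) (hp1 : p ≤ 1) {q : ℝ} (hq0 : 0 ≤ q)
    (hqp : q ≤ p) (hqp' : q ≤ 1 - p) (hq2 : q ≤ 1 / 2) {n : ℕ} {s : M.State}
    (h : M.HaltsWithin n s) : (M.avg p)^[n] M.running s ≤ 1 - q ^ n := by
  have hq1 : q ≤ 1 := by linarith
  have hhalt : ∀ n s, M.Halted s → (M.avg p)^[n] M.running s ≤ 1 - q ^ n := by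
    intro n s hs
    rw [avg_iterate_of_halted hs, running_of_halted hs]
    linarith [pow_le_one₀ hq0 hq1 (n := n)]
  induction n generalizing s with
  | zero => exact hhalt 0 s h
  | succ n ih =>
    rcases h with h | ⟨h, b, hb⟩
    · exact hhalt _ s h
    · rw [Function.iterate_succ_apply', pow_succ]
      have h1 := ih hb
      have h2 := avg_iterate_running_le_one hp0 hp1 n (M.next s (!b))
      have hqn : 0 ≤ q ^ n := pow_nonneg hq0 n
      set g := (M.avg p)^[n] M.running
      have key : ∀ w x y : ℝ, q ≤ w → w ≤ 1 → x ≤ 1 - q ^ n → y ≤ 1 →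
          w * x + (1 - w) * y ≤ 1 - q ^ n * q := fun w x y hw hw1 hx hy => by
        nlinarith [mul_le_mul_of_nonneg_left hx (hq0.trans hw),
          mul_le_mul_of_nonneg_left hy (sub_nonneg.2 hw1), mul_le_mul_of_nonneg_left hw hqn]
      rcases h with h | h <;> cases b <;> simp only [avg, h] <;>
        simp only [Bool.not_true, Bool.not_false] at h2
      · linarith [key (1 / 2) _ _ hq2 (by norm_num) h1 h2]
      · linarith [key (1 / 2) _ _ hq2 (by norm_num) h1 h2]
      · linarith [key (1 - p) _ _ hqp' (by linarith) h1 h2]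
      · exact key p _ _ hqp hp1 h1 h2

/-- Geometric decay of the probability of not having halted. -/
lemma avg_iterate_running_mul_le (hp0 : 0 ≤ p) (hp1 : p ≤ 1) {I : Set M.State}
    (hI : ∀ s ∈ I, ∀ b, M.next s b ∈ I) {L : ℕ} {r : ℝ} (hr : 0 ≤ r)
    (h : ∀ s ∈ I, (M.avg p)^[L] M.running s ≤ r) (k : ℕ) {s : M.State} (hs : s ∈ I) :
    (M.avg p)^[L * k] M.running s ≤ r ^ k := by
  induction k generalizing s with
  | zero => simpa using running_le_one s
  | succ k ih =>
    rw [Nat.mul_succ, Nat.add_comm, Function.iterate_add_apply]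
    -- The induction hypothesis improves to `r ^ k • M.running`, since both sides vanish at halted
    -- states; the last `L` applications then contribute one more factor `r`.
    calc (M.avg p)^[L] ((M.avg p)^[L * k] M.running) s
        ≤ (M.avg p)^[L] (r ^ k • M.running) s := by
          refine avg_iterate_mono hp0 hp1 hI (fun s hs => ?_) L hs
          by_cases hh : M.Halted s
          · simp [avg_iterate_of_halted hh, running_of_halted hh]
          · simpa [running_of_not_halted hh] using ih hs
      _ = r ^ k * (M.avg p)^[L] M.running s := by rw [avg_iterate_smul]; rfl
      _ ≤ r ^ k * r := by gcongr; exact h s hs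
      _ = r ^ (k + 1) := (pow_succ r k).symm

/-- Exponential decay of the probability of not having halted, when a halting state can be reached
within a bounded number of steps from everywhere. -/
lemma exists_avg_iterate_running_le (hp0 : 0 < p) (hp1 : p < 1) {I : Set M.State}
    (hI : ∀ s ∈ I, ∀ b, M.next s b ∈ I) {L : ℕ} (h : ∀ s ∈ I, M.HaltsWithin L s) :
    ∃ K ρ : ℝ, 0 ≤ ρ ∧ ρ < 1 ∧
      ∀ s ∈ I, ∀ m : ℕ, (M.avg p)^[m] M.running s ≤ K * ρ ^ m := by
  set q := min (min p (1 - p)) (1 / 2)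
  have hq0 : 0 < q := by simp [q, hp0, hp1]
  have hqp : q ≤ p := (min_le_left _ _).trans (min_le_left _ _)
  have hqp' : q ≤ 1 - p := (min_le_left _ _).trans (min_le_right _ _)
  have hq2 : q ≤ 1 / 2 := min_le_right _ _
  -- The exponent `L + 1` is never zero, which keeps `r` positive and its root below meaningful even
  -- when `L = 0`.
  set r := 1 - q ^ (L + 1)
  have hr1 : r < 1 := by simp only [r]; linarith [pow_pos hq0 (L + 1)]
  have hr0 : 0 < r := by
    have : q ^ (L + 1) ≤ q ^ 1 := pow_le_pow_of_le_one hq0.le (by linarith) (by omega)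
    simp only [r]; linarith
  obtain ⟨ρ, hρ0, hρ⟩ : ∃ ρ : ℝ, 0 < ρ ∧ ρ ^ (L + 1) = r :=
    ⟨r ^ (((L + 1 : ℕ) : ℝ)⁻¹), Real.rpow_pos_of_pos hr0 _,
      Real.rpow_inv_natCast_pow hr0.le (Nat.succ_ne_zero L)⟩
  have hρ1 : ρ < 1 := by
    by_contra hc
    exact absurd (one_le_pow₀ (not_lt.1 hc) (n := L + 1)) (by rw [hρ]; exact not_le.2 hr1)
  -- The factor `r⁻¹` pays for rounding `m` down to a multiple of `L + 1`.
  refine ⟨r⁻¹, ρ, hρ0.le, hρ1, fun s hs m => ?_⟩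
  have hle : ∀ s ∈ I, (M.avg p)^[L + 1] M.running s ≤ r := fun s hs =>
    ((h s hs).mono M (Nat.le_succ L)).avg_iterate_running_le hp0.le hp1.le hq0.le hqp hqp' hq2
  calc (M.avg p)^[m] M.running s ≤ (M.avg p)^[(L + 1) * (m / (L + 1))] M.running s :=
        avg_iterate_running_antitone hp0.le hp1.le s (Nat.mul_div_le m (L + 1))
    _ ≤ r ^ (m / (L + 1)) := avg_iterate_running_mul_le hp0.le hp1.le hI hr0.le hle _ hs
    _ = r⁻¹ * ρ ^ ((L + 1) * (m / (L + 1)) + (L + 1)) := by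
        rw [pow_add, pow_mul, hρ]; field_simp
    _ ≤ r⁻¹ * ρ ^ m := by
        gcongr r⁻¹ * ?_
        refine pow_le_pow_of_le_one hρ0.le hρ1.le ?_
        have := Nat.div_add_mod m (L + 1)
        have : m % (L + 1) < L + 1 := Nat.mod_lt m (Nat.succ_pos L)
        omega

end Operator

/-! ### From harmonic functions to strong realization -/

lemma run_eq_of_halted {ω : (ℕ → Bool) × (ℕ → Bool)} {m : ℕ}
    (h : M.Halted (M.run ω m).state) {n : ℕ} (hn : m ≤ n) : M.run ω n = M.run ω m := by
  obtain ⟨b, hb⟩ := h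
  induction n, hn using Nat.le_induction with
  | base => rfl
  | succ n _ ih =>
    have : M.run ω (n + 1) = M.step ω (M.run ω n) := Function.iterate_succ_apply' _ _ _
    rw [this, ih]
    simp [step, hb]

lemma run_count_le (ω : (ℕ → Bool) × (ℕ → Bool)) (n : ℕ) :
    (M.run ω n).flips + (M.run ω n).inputs ≤ n := by
  induction n with
  | zero => simp [run]
  | succ n ih =>
    have : M.run ω (n + 1) = M.step ω (M.run ω n) := Function.iterate_succ_apply' _ _ _
    rw [this]
    unfold step
    cases M.instr (M.run ω n).state <;> dsimp only <;> omega

lemma cost_le_of_halted {ω : (ℕ → Bool) × (ℕ → Bool)} {m : ℕ}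
    (h : M.Halted (M.run ω m).state) : M.cost ω ≤ m := by
  refine iSup_le fun n => ?_
  rcases le_total m n with hn | hn
  · rw [M.run_eq_of_halted h hn]
    exact_mod_cast M.run_count_le ω m
  · exact_mod_cast (M.run_count_le ω n).trans hn

lemma outputs_iff_of_halted {ω : (ℕ → Bool) × (ℕ → Bool)} {m : ℕ}
    (h : M.Halted (M.run ω m).state) (b : Bool) :
    M.Outputs ω b ↔ M.instr (M.run ω m).state = .halt b := by
  refine ⟨?_, fun h => ⟨m, h⟩⟩
  rintro ⟨n, hn⟩
  rcases le_total m n with hmn | hmn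
  · rwa [← M.run_eq_of_halted h hmn]
  · rwa [M.run_eq_of_halted ⟨b, hn⟩ hmn]

/-- A criterion for a machine to realize a function strongly. On a set `I` of states that contains
the initial state and is preserved by the computation, `v p` is a harmonic function that describes
the probability of the output `true`, and a halting state is within reach in a bounded number of
steps. -/
theorem stronglyRealizes_of_harmonic {φ : ℝ → ℝ} {I : Set M.State} (hstart : M.start ∈ I)
    (hI : ∀ s ∈ I, ∀ b, M.next s b ∈ I) {L : ℕ} (hL : ∀ s ∈ I, M.HaltsWithin L s)
    (v : ℝ → M.State → ℝ)
    (hv0 : ∀ p ∈ Set.Ioo (0 : ℝ) 1, ∀ s ∈ I, 0 ≤ v p s)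
    (hv1 : ∀ p ∈ Set.Ioo (0 : ℝ) 1, ∀ s ∈ I, v p s ≤ 1)
    (hhalt : ∀ p ∈ Set.Ioo (0 : ℝ) 1, ∀ s ∈ I, ∀ b, M.instr s = .halt b →
      v p s = if b then 1 else 0)
    (hharm : ∀ p ∈ Set.Ioo (0 : ℝ) 1, ∀ s ∈ I, M.avg p (v p) s = v p s)
    (hφ : ∀ p ∈ Set.Ioo (0 : ℝ) 1, v p M.start = φ p) : M.StronglyRealizes φ := by
  intro p hp0 hp1
  have hp : (p : ℝ) ∈ Set.Ioo (0 : ℝ) 1 := ⟨hp0, hp1⟩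
  obtain ⟨K, ρ, hρ0, hρ1, hK⟩ := exists_avg_iterate_running_le hp.1 hp.2 hI hL
  have hnot : ∀ n, (buffonSource p).real {ω | ¬ M.Halted (M.run ω n).state} ≤ K * ρ ^ n :=
    fun n => (M.measureReal_stateAfter p n M.start {s | ¬ M.Halted s}).trans_le (hK _ hstart n)
  have hlim : Filter.Tendsto (fun n => K * ρ ^ n) Filter.atTop (nhds 0) := by
    simpa using (tendsto_pow_atTop_nhds_zero_of_lt_one hρ0 hρ1).const_mul K
  refine ⟨?_, ?_, K, ρ, hρ0, hρ1, fun m => ?_⟩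
  · rw [ae_iff, ← measureReal_eq_zero_iff]
    refine le_antisymm (ge_of_tendsto' hlim fun n => (measureReal_mono ?_).trans (hnot n))
      measureReal_nonneg
    rintro ω hω ⟨b, hb⟩
    exact hω ⟨b, n, hb⟩
  · have htrue : ∀ n, (buffonSource p).real {ω | M.instr (M.run ω n).state = .halt true} =
        (M.avg p)^[n] ({s | M.instr s = .halt true}.indicator 1) M.start :=
      fun n => M.measureReal_stateAfter p n M.start {s | M.instr s = .halt true}
    set A : M.State → ℝ := {s | M.instr s = .halt true}.indicator 1
    -- `v p` lies between `A` and `A + M.running`. Iterating the operator fixes `v p` and traps `φ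
    -- p` between the probability of having output `true` and that probability plus the running
    -- probability.
    have hle : ∀ s ∈ I, A s ≤ v p s := by
      intro s hs
      by_cases h : M.instr s = .halt true
      · simp [A, h, hhalt p hp s hs true h]
      · simpa [A, h] using hv0 p hp s hs
    have hge : ∀ s ∈ I, v p s ≤ (A + M.running) s := by
      intro s hs
      by_cases h : M.Halted s
      · obtain ⟨b, hb⟩ := h
        rw [hhalt p hp s hs b hb, Pi.add_apply, running_of_halted ⟨b, hb⟩]
        cases b <;> simp [A, hb]
      · have hA : 0 ≤ A s := Set.indicator_nonneg (fun _ _ => zero_le_one) s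
        rw [Pi.add_apply, running_of_not_halted h]
        linarith [hv1 p hp s hs]
    have hfix : ∀ n, (M.avg p)^[n] (v p) M.start = φ p := fun n => by
      rw [avg_iterate_eq_self hI (hharm p hp) n hstart, hφ p hp]
    have hupper : ∀ n, (M.avg p)^[n] A M.start ≤ φ p := fun n =>
      (avg_iterate_mono hp.1.le hp.2.le hI hle n hstart).trans_eq (hfix n)
    have hlower : ∀ n, φ p ≤ (M.avg p)^[n] A M.start + K * ρ ^ n := fun n => by
      have := avg_iterate_mono hp.1.le hp.2.le hI hge n hstart
      rw [hfix, avg_iterate_add, Pi.add_apply] at this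
      linarith [hK _ hstart n]
    have h1 : ∀ n, (buffonSource p).real {ω | M.Outputs ω true} ≤ φ p + K * ρ ^ n := fun n => by
      have hsub : {ω | M.Outputs ω true} ⊆ {ω | M.instr (M.run ω n).state = .halt true} ∪
          {ω | ¬ M.Halted (M.run ω n).state} := by
        intro ω hω
        by_cases h : M.Halted (M.run ω n).state
        · exact Or.inl ((M.outputs_iff_of_halted h true).1 hω)
        · exact Or.inr h
      refine (measureReal_mono hsub).trans ((measureReal_union_le _ _).trans ?_)
      rw [htrue]
      exact add_le_add (hupper n) (hnot n)
    have h2 : ∀ n, φ p ≤ (buffonSource p).real {ω | M.Outputs ω true} + K * ρ ^ n := fun n => by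
      refine (hlower n).trans ?_
      rw [← htrue]
      have hsub : {ω | M.instr (M.run ω n).state = .halt true} ⊆ {ω | M.Outputs ω true} :=
        fun ω hω => ⟨n, hω⟩
      exact add_le_add (measureReal_mono hsub) le_rfl
    refine le_antisymm (ge_of_tendsto' (x := Filter.atTop) ?_ h1)
      (ge_of_tendsto' (x := Filter.atTop) ?_ h2)
    · simpa using hlim.const_add (φ p)
    · simpa using hlim.const_add ((buffonSource p).real {ω | M.Outputs ω true})
  · refine (measureReal_mono ?_).trans (hnot m)
    intro ω hω h
    exact absurd (M.cost_le_of_halted h) (not_le.2 hω)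

end BuffonMachine

/-! ### The geometric machine and its computability -/

/-- States of the geometric machine: halted with an output, counting the successes in the input, or
comparing a uniform binary fraction with a ratio, where a success yields the stored output. -/
abbrev GeometricState : Type := Bool ⊕ ℕ ⊕ (Bool × ℕ × ℕ)

/-- The transitions of the geometric machine. -/
def geometricNext (c restart : Bool) (num den : ℕ → ℕ) (out : ℕ → Bool) :
    GeometricState → Bool → GeometricState
  | .inl o, _ => .inl o
  | .inr (.inl n), b =>
      bif b == c then .inr (.inl (n + 1)) else .inr (.inr (out n, num n, den n))
  -- The next binary digit of `a / d` is 1 exactly when `d ≤ 2 * a`. The flip is a digit of a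
  -- uniform number, and the first disagreement decides. For `a = d` all digits are 1, so failure is
  -- impossible.
  | .inr (.inr (o, a, d)), b =>
      if d ≤ 2 * a then bif b then .inr (.inr (o, 2 * a - d, d)) else .inl o
      else bif b then bif restart then .inr (.inl 0) else .inl false
      else .inr (.inr (o, 2 * a, d))

/-- The instructions of the geometric machine. -/
def geometricInstr : GeometricState → BuffonInstr
  | .inl o => .halt o
  | .inr (.inl _) => .input
  | .inr (.inr _) => .flip

lemma computable_geometricInstr : Computable geometricInstr := by
  have h : Primrec fun s : GeometricState =>
      (Sum.casesOn s (fun o => BuffonInstr.halt o)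
        fun t => Sum.casesOn t (fun _ => BuffonInstr.input) fun _ => BuffonInstr.flip :
          BuffonInstr) := by
    refine Primrec.sumCasesOn .id ((Primrec.dom_bool BuffonInstr.halt).comp .snd).to₂ ?_
    exact (Primrec.sumCasesOn .snd (Primrec.const _).to₂ (Primrec.const _).to₂).to₂
  exact (h.of_eq fun s => by rcases s with o | n | t <;> rfl).to_comp

lemma computable_geometricNext (c restart : Bool) {num den : ℕ → ℕ} {out : ℕ → Bool}
    (hnum : Computable num) (hden : Computable den) (hout : Computable out) :
    Computable₂ (geometricNext c restart num den out) := by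
  have h1 : Computable₂ fun (x : GeometricState × Bool) (o : Bool) => (.inl o : GeometricState) :=
    (Computable.sumInl.comp .snd).to₂
  have h2 : Computable₂ fun (x : GeometricState × Bool) (n : ℕ) =>
      (bif x.2 == c then .inr (.inl (n + 1)) else .inr (.inr (out n, num n, den n)) :
        GeometricState) := by
    refine Computable₂.mk (Computable.cond ?_ ?_ ?_)
    · exact (Primrec.dom_bool (fun b => b == c)).to_comp.comp (Computable.snd.comp .fst)
    · exact Computable.sumInr.comp (Computable.sumInl.comp (Computable.succ.comp .snd))
    · exact Computable.sumInr.comp (Computable.sumInr.comp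
        ((hout.comp .snd).pair ((hnum.comp .snd).pair (hden.comp .snd))))
  have h3 : Primrec₂ fun (x : GeometricState × Bool) (t : Bool × ℕ × ℕ) =>
      (if t.2.2 ≤ 2 * t.2.1 then
        bif x.2 then .inr (.inr (t.1, 2 * t.2.1 - t.2.2, t.2.2)) else .inl t.1
      else bif x.2 then bif restart then .inr (.inl 0) else .inl false
      else .inr (.inr (t.1, 2 * t.2.1, t.2.2)) : GeometricState) := by
    have ho : Primrec fun y : (GeometricState × Bool) × (Bool × ℕ × ℕ) => y.2.1 :=
      Primrec.fst.comp .snd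
    have ha : Primrec fun y : (GeometricState × Bool) × (Bool × ℕ × ℕ) => 2 * y.2.2.1 :=
      Primrec.nat_double.comp (Primrec.fst.comp (Primrec.snd.comp .snd))
    have hd : Primrec fun y : (GeometricState × Bool) × (Bool × ℕ × ℕ) => y.2.2.2 :=
      Primrec.snd.comp (Primrec.snd.comp .snd)
    have hb : Primrec fun y : (GeometricState × Bool) × (Bool × ℕ × ℕ) => y.1.2 :=
      Primrec.snd.comp .fst
    refine Primrec₂.mk (Primrec.ite (Primrec.nat_le.comp hd ha) (Primrec.cond hb ?_ ?_)
      (Primrec.cond hb (Primrec.const _) ?_))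
    · exact Primrec.sumInr.comp (Primrec.sumInr.comp
        (ho.pair ((Primrec.nat_sub.comp ha hd).pair hd)))
    · exact Primrec.sumInl.comp ho
    · exact Primrec.sumInr.comp (Primrec.sumInr.comp (ho.pair (ha.pair hd)))
  have h4 : Computable₂ fun (x : GeometricState × Bool) (t : ℕ ⊕ (Bool × ℕ × ℕ)) =>
      (Sum.casesOn t
        (fun n => bif x.2 == c then .inr (.inl (n + 1)) else .inr (.inr (out n, num n, den n)))
        fun t => if t.2.2 ≤ 2 * t.2.1 then
          bif x.2 then .inr (.inr (t.1, 2 * t.2.1 - t.2.2, t.2.2)) else .inl t.1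
          else bif x.2 then bif restart then .inr (.inl 0) else .inl false
          else .inr (.inr (t.1, 2 * t.2.1, t.2.2)) : GeometricState) :=
    (Computable.sumCasesOn .snd
      (Computable₂.comp₂ h2 (Computable.fst.comp .fst).to₂ Computable.snd.to₂)
      (Computable₂.comp₂ h3.to_comp (Computable.fst.comp .fst).to₂ Computable.snd.to₂)).to₂
  exact (Computable.sumCasesOn (f := fun x : GeometricState × Bool => x.1) .fst h1 h4).of_eq
    fun ⟨s, b⟩ => by rcases s with o | n | ⟨o, a, d⟩ <;> rfl

/-- The geometric machine. It counts the input bits equal to `c` before the first one that is not;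
if their number is `n`, it then succeeds with probability `num n / den n`, and outputs `out n` in
this case. Upon a failure it starts afresh or outputs `false`. -/
def geometricMachine (c restart : Bool) {num den : ℕ → ℕ} {out : ℕ → Bool}
    (hnum : Computable num) (hden : Computable den) (hout : Computable out) : BuffonMachine where
  State := GeometricState
  start := .inr (.inl 0)
  instr := geometricInstr
  next := geometricNext c restart num den out
  computable_instr := computable_geometricInstr
  computable_next := computable_geometricNext c restart hnum hden hout

/-- The probability that an input bit of parameter `x` is equal to `c`. -/
def bias (c : Bool) (x : ℝ) : ℝ := bif c then x else 1 - x

lemma bias_mem (c : Bool) {x : ℝ} (hx : x ∈ Set.Ioo (0 : ℝ) 1) : bias c x ∈ Set.Ioo (0 : ℝ) 1 := by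
  cases c
  · exact ⟨sub_pos.2 hx.2, by simpa [bias] using hx.1⟩
  · exact hx

/-! ### Output probabilities of the geometric machine -/

section Value

variable (a : ℕ → ℝ) (out : ℕ → Bool) (r : ℝ)

/-- The probability of the output `true` when `n` successes have been counted, if a failure leads to
it with probability `r`. -/
def countValue (n : ℕ) : ℝ := a n * (if out n then 1 else 0) + (1 - a n) * r

/-- The probability of the output `true` while `n` successes have been counted so far, for inputs
of parameter `y`. -/
noncomputable def tailValue (y : ℝ) (n : ℕ) : ℝ :=
  (1 - y) * ∑' k, countValue a out r (n + k) * y ^ k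

/-- The probability of the output `true` from a state of the geometric machine. -/
noncomputable def geometricValue (y : ℝ) : GeometricState → ℝ
  | .inl o => if o then 1 else 0
  | .inr (.inl n) => tailValue a out r y n
  | .inr (.inr (o, k, d)) => (k / d : ℝ) * (if o then 1 else 0) + (1 - (k / d : ℝ)) * r

variable {a out r}

lemma countValue_mem (ha : ∀ n, a n ∈ Set.Icc (0 : ℝ) 1) (hr : r ∈ Set.Icc (0 : ℝ) 1) (n : ℕ) :
    countValue a out r n ∈ Set.Icc (0 : ℝ) 1 := by
  obtain ⟨ha0, ha1⟩ := ha n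
  obtain ⟨hr0, hr1⟩ := hr
  unfold countValue
  constructor
  · split_ifs <;> nlinarith
  · split_ifs <;> nlinarith

lemma summable_mul_geometric {f : ℕ → ℝ} (hf : ∀ n, f n ∈ Set.Icc (0 : ℝ) 1) {y : ℝ}
    (hy : y ∈ Set.Ioo (0 : ℝ) 1) : Summable fun n => f n * y ^ n :=
  (summable_geometric_of_lt_one hy.1.le hy.2).of_nonneg_of_le
    (fun n => mul_nonneg (hf n).1 (pow_nonneg hy.1.le n))
    fun n => mul_le_of_le_one_left (pow_nonneg hy.1.le n) (hf n).2

lemma tailValue_mem (ha : ∀ n, a n ∈ Set.Icc (0 : ℝ) 1) (hr : r ∈ Set.Icc (0 : ℝ) 1) {y : ℝ}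
    (hy : y ∈ Set.Ioo (0 : ℝ) 1) (n : ℕ) : tailValue a out r y n ∈ Set.Icc (0 : ℝ) 1 := by
  have h := fun k => countValue_mem (out := out) ha hr (n + k)
  have hy1 : 0 < 1 - y := sub_pos.2 hy.2
  refine ⟨mul_nonneg hy1.le (tsum_nonneg fun k => mul_nonneg (h k).1 (pow_nonneg hy.1.le k)), ?_⟩
  calc tailValue a out r y n ≤ (1 - y) * ∑' k, y ^ k := by
        unfold tailValue
        exact mul_le_mul_of_nonneg_left ((summable_mul_geometric h hy).tsum_le_tsum
          (fun k => mul_le_of_le_one_left (pow_nonneg hy.1.le k) (h k).2)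
          (summable_geometric_of_lt_one hy.1.le hy.2)) hy1.le
    _ = 1 := by rw [tsum_geometric_of_lt_one hy.1.le hy.2, mul_inv_cancel₀ hy1.ne']

/-- Splitting off the term `k = 0` conditions on the next input bit: this is harmonicity at a
counting state. -/
lemma tailValue_eq (ha : ∀ n, a n ∈ Set.Icc (0 : ℝ) 1) (hr : r ∈ Set.Icc (0 : ℝ) 1) {y : ℝ}
    (hy : y ∈ Set.Ioo (0 : ℝ) 1) (n : ℕ) :
    tailValue a out r y n = (1 - y) * countValue a out r n + y * tailValue a out r y (n + 1) := by
  have h := fun k => countValue_mem (out := out) ha hr (n + k)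
  unfold tailValue
  rw [(summable_mul_geometric h hy).tsum_eq_zero_add]
  have : ∀ k, countValue a out r (n + (k + 1)) * y ^ (k + 1) =
      y * (countValue a out r (n + 1 + k) * y ^ k) := fun k => by
    rw [show n + (k + 1) = n + 1 + k by ring]; ring
  simp only [this, tsum_mul_left, Nat.add_zero, pow_zero]
  ring

end Value

/-- Here `r` is the probability of `true` after a failure: 0 without restarts, `φ` itself with them,
in which case `hφ` is a fixed-point equation. With these values `geometricValue` is harmonic. With
restarts, an index of acceptance probability 1 keeps a halt within bounded reach. -/
theorem geometricMachine_stronglyRealizes (c restart : Bool) {num den : ℕ → ℕ} {out : ℕ → Bool}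
    (hnum : Computable num) (hden : Computable den) (hout : Computable out)
    (hpos : ∀ n, 0 < den n) (hle : ∀ n, num n ≤ den n)
    (haccept : restart = true → ∃ n, num n = den n) {φ : ℝ → ℝ} {r : ℝ → ℝ}
    (hr : ∀ p ∈ Set.Ioo (0 : ℝ) 1, r p ∈ Set.Icc (0 : ℝ) 1)
    (hrφ : ∀ p ∈ Set.Ioo (0 : ℝ) 1, r p = bif restart then φ p else 0)
    (hφ : ∀ p ∈ Set.Ioo (0 : ℝ) 1,
      tailValue (fun n => (num n / den n : ℝ)) out (r p) (bias c p) 0 = φ p) :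
    (geometricMachine c restart hnum hden hout).StronglyRealizes φ := by
  set M := geometricMachine c restart hnum hden hout
  set a : ℕ → ℝ := fun n => (num n / den n : ℝ)
  have ha : ∀ n, a n ∈ Set.Icc (0 : ℝ) 1 := fun n =>
    ⟨by positivity, div_le_one_of_le₀ (by exact_mod_cast hle n) (by positivity)⟩
  let I : Set GeometricState :=
    {s | ∀ o a d, s = .inr (.inr (o, a, d)) → 0 < d ∧ a ≤ d}
  have hIbern : ∀ o a d, (Sum.inr (Sum.inr (o, a, d)) : GeometricState) ∈ I ↔ 0 < d ∧ a ≤ d := by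
    intro o a d
    constructor
    · exact fun h => h o a d rfl
    · rintro h o' a' d' h'
      simp only [Sum.inr.injEq, Prod.mk.injEq] at h'
      obtain ⟨rfl, rfl, rfl⟩ := h'
      exact h
  have hIhalt : ∀ o, (Sum.inl o : GeometricState) ∈ I := fun o o' a d h => by cases h
  have hIcount : ∀ n, (Sum.inr (Sum.inl n) : GeometricState) ∈ I := fun n o' a d h => by cases h
  have hhalted : ∀ n o, M.HaltsWithin n (Sum.inl o : GeometricState) := fun n o =>
    BuffonMachine.HaltsWithin.mono M (n := 0) ⟨o, rfl⟩ (Nat.zero_le n)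
  -- `L` bits suffice after a failure. On a restart: count up to an `n` with `num n = den n`, end
  -- the count, and flip `false`, which accepts at once.
  obtain ⟨L, hL⟩ : ∃ L, M.HaltsWithin L
      (bif restart then .inr (.inl 0) else .inl false : GeometricState) := by
    cases hrs : restart
    · exact ⟨0, hhalted 0 false⟩
    · obtain ⟨n, hn⟩ := haccept hrs
      have hlast : M.HaltsWithin 2 (Sum.inr (Sum.inl n) : GeometricState) := by
        refine Or.inr ⟨Or.inr rfl, !c, ?_⟩
        change M.HaltsWithin 1 (geometricNext c restart num den out (.inr (.inl n)) (!c))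
        have : ((!c) == c) = false := by cases c <;> rfl
        simp only [geometricNext, this, cond_false]
        refine Or.inr ⟨Or.inl rfl, false, ?_⟩
        change M.HaltsWithin 0
          (geometricNext c restart num den out (.inr (.inr (out n, num n, den n))) false)
        have : den n ≤ 2 * num n := by omega
        simp only [geometricNext, this, if_true, cond_false]
        exact hhalted 0 _
      have hcount : ∀ k ≤ n, M.HaltsWithin (k + 2) (Sum.inr (Sum.inl (n - k)) : GeometricState) := by
        intro k hk
        induction k with
        | zero => exact hlast
        | succ k ih =>
          refine Or.inr ⟨Or.inr rfl, c, ?_⟩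
          change M.HaltsWithin (k + 2)
            (geometricNext c restart num den out (.inr (.inl (n - (k + 1)))) c)
          simp only [geometricNext, beq_self_eq_true, cond_true]
          rw [show n - (k + 1) + 1 = n - k by omega]
          exact ih (by omega)
      exact ⟨n + 2, by simpa using hcount n le_rfl⟩
  have hbern : ∀ o a d, M.HaltsWithin (L + 1) (Sum.inr (Sum.inr (o, a, d)) : GeometricState) := by
    intro o a d
    -- A flip opposite to the current binary digit ends the comparison.
    refine Or.inr ⟨Or.inl rfl, !decide (d ≤ 2 * a), ?_⟩
    change M.HaltsWithin L (geometricNext c restart num den out (.inr (.inr (o, a, d)))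
      (!decide (d ≤ 2 * a)))
    by_cases h : d ≤ 2 * a
    · simpa [geometricNext, h] using hhalted L o
    · simpa [geometricNext, h] using hL
  have hI : ∀ s ∈ I, ∀ b, geometricNext c restart num den out s b ∈ I := by
    rintro (o | n | ⟨o, k, d⟩) hs b
    · exact hIhalt o
    · cases hb : b == c <;> simp only [geometricNext, hb, cond_true, cond_false]
      · exact (hIbern _ _ _).2 ⟨hpos n, hle n⟩
      · exact hIcount _
    · rw [hIbern] at hs
      simp only [geometricNext]
      split_ifs with h <;> cases b <;> simp only [cond_true, cond_false]
      · exact hIhalt o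
      · exact (hIbern _ _ _).2 (by omega)
      · exact (hIbern _ _ _).2 (by omega)
      · cases restart
        · exact hIhalt false
        · exact hIcount 0
  have hvalue : ∀ p ∈ Set.Ioo (0 : ℝ) 1, ∀ s ∈ I,
      geometricValue a out (r p) (bias c p) s ∈ Set.Icc (0 : ℝ) 1 := by
    rintro p hp (o | n | ⟨o, k, d⟩) hs
    · cases o <;> simp [geometricValue]
    · exact tailValue_mem ha (hr p hp) (bias_mem c hp) n
    · obtain ⟨hd, hk⟩ := (hIbern _ _ _).1 hs
      exact countValue_mem (a := fun _ => (k / d : ℝ)) (out := fun _ => o)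
        (fun _ => ⟨by positivity, div_le_one_of_le₀ (by exact_mod_cast hk) (by positivity)⟩)
        (hr p hp) 0
  -- One input bit to end the count, one flip to end the comparison, and `L` bits after a failure.
  refine M.stronglyRealizes_of_harmonic (I := I) (L := L + 2) (hIcount 0) hI ?_
    (fun p => geometricValue a out (r p) (bias c p)) (fun p hp s hs => (hvalue p hp s hs).1)
    (fun p hp s hs => (hvalue p hp s hs).2) ?_ ?_ hφ
  · rintro (o | n | ⟨o, k, d⟩) hs
    · exact hhalted _ o
    · refine Or.inr ⟨Or.inr rfl, !c, ?_⟩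
      change M.HaltsWithin (L + 1) (geometricNext c restart num den out (.inr (.inl n)) (!c))
      have : ((!c) == c) = false := by cases c <;> rfl
      simp only [geometricNext, this, cond_false]
      exact hbern _ _ _
    · exact (hbern o k d).mono M (by omega)
  · rintro p hp (o | n | ⟨o, k, d⟩) hs b hb
    · cases hb; rfl
    · cases hb
    · cases hb
  · rintro p hp (o | n | ⟨o, k, d⟩) hs
    · rfl
    · refine Eq.trans ?_ (tailValue_eq ha (hr p hp) (bias_mem c hp) n).symm
      change p * geometricValue a out (r p) (bias c p)
          (geometricNext c restart num den out (.inr (.inl n)) true) +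
        (1 - p) * geometricValue a out (r p) (bias c p)
          (geometricNext c restart num den out (.inr (.inl n)) false) = _
      cases c
      · simp [geometricNext, geometricValue, bias, countValue, a]
      · simp [geometricNext, geometricValue, bias, countValue, a]
        ring
    · obtain ⟨hd, hk⟩ := (hIbern _ _ _).1 hs
      have hd' : (d : ℝ) ≠ 0 := by positivity
      change 1 / 2 * geometricValue a out (r p) (bias c p)
          (geometricNext c restart num den out (.inr (.inr (o, k, d))) true) +
        1 / 2 * geometricValue a out (r p) (bias c p)
          (geometricNext c restart num den out (.inr (.inr (o, k, d))) false) = _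
      by_cases h : d ≤ 2 * k
      · simp only [geometricNext, h, if_true, cond_true, cond_false, geometricValue,
          Nat.cast_sub h]
        push_cast
        field_simp
        ring
      · have hrest : geometricValue a out (r p) (bias c p)
            (bif restart then .inr (.inl 0) else .inl false) = r p := by
          have h1 := hφ p hp
          have h2 := hrφ p hp
          cases restart
          · simpa [geometricValue] using h2.symm
          · exact h1.trans h2.symm
        simp only [geometricNext, h, if_false, cond_true, cond_false, hrest]
        simp only [geometricValue]
        push_cast
        field_simp
        ring

/-! ### The two constructions: a single round, and rounds until success -/

section Geometric

variable {num den : ℕ → ℕ} {A : ℝ → ℝ}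

/-- One round of the geometric machine. -/
theorem stronglyRealizable_one_sub_mul (c : Bool) (hnum : Computable num) (hden : Computable den)
    (hpos : ∀ n, 0 < den n) (hle : ∀ n, num n ≤ den n) (hnonzero : ∃ n, 0 < num n)
    (hlt : ∃ n, num n < den n)
    (hA : ∀ y ∈ Set.Ioo (0 : ℝ) 1, HasSum (fun n => (num n / den n : ℝ) * y ^ n) (A y)) :
    StronglyRealizable fun x => (1 - bias c x) * A (bias c x) := by
  have ha0 : ∀ n, 0 ≤ (num n / den n : ℝ) := fun n => by positivity
  have ha1 : ∀ n, (num n / den n : ℝ) ≤ 1 := fun n =>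
    div_le_one_of_le₀ (by exact_mod_cast hle n) (by positivity)
  refine ⟨fun x hx => ?_, _, geometricMachine_stronglyRealizes c false hnum hden
    (Computable.const true) hpos hle (fun h => by cases h) (r := fun _ => 0)
    (fun p hp => ⟨le_rfl, zero_le_one⟩) (fun p hp => rfl) fun p hp => ?_⟩
  · have hy := bias_mem c hx
    set y := bias c x
    have hy1 : 0 < 1 - y := sub_pos.2 hy.2
    obtain ⟨m, hm⟩ := hnonzero
    obtain ⟨l, hl⟩ := hlt
    have hpow := fun n => pow_pos hy.1 n
    have hA0 : 0 < A y := by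
      refine hasSum_lt (i := m) (fun n => mul_nonneg (ha0 n) (hpow n).le) ?_ hasSum_zero (hA y hy)
      have := hpos m
      have := hpow m
      positivity
    have hA1 : A y < (1 - y)⁻¹ := by
      refine hasSum_lt (i := l) (fun n => mul_le_of_le_one_left (hpow n).le (ha1 n)) ?_ (hA y hy)
        (hasSum_geometric_of_lt_one hy.1.le hy.2)
      refine mul_lt_of_lt_one_left (hpow l) ?_
      rw [div_lt_one (by exact_mod_cast hpos l)]
      exact_mod_cast hl
    refine ⟨mul_pos hy1 hA0, ?_⟩
    calc (1 - y) * A y < (1 - y) * (1 - y)⁻¹ := by gcongr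
      _ = 1 := mul_inv_cancel₀ hy1.ne'
  · simp only [tailValue, countValue, Nat.zero_add, if_true, mul_one, mul_zero, add_zero]
    rw [(hA _ (bias_mem c hp)).tsum_eq]

/-- Rounds of the geometric machine until the first success. -/
theorem stronglyRealizable_pow_div (c : Bool) (k : ℕ) (hnum : Computable num)
    (hden : Computable den) (hpos : ∀ n, 0 < den n) (hle : ∀ n, num n ≤ den n)
    (hk : num k = den k) (hnonzero : ∃ n, n ≠ k ∧ 0 < num n)
    (hA : ∀ y ∈ Set.Ioo (0 : ℝ) 1, HasSum (fun n => (num n / den n : ℝ) * y ^ n) (A y)) :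
    StronglyRealizable fun x => bias c x ^ k / A (bias c x) := by
  have hout : Computable fun n => decide (n = k) :=
    (Primrec.eq.comp Primrec.id (Primrec.const k)).decide.to_comp
  have hak : (num k / den k : ℝ) = 1 := by
    rw [hk, div_self]
    exact_mod_cast (hpos k).ne'
  have hrange : ∀ x ∈ Set.Ioo (0 : ℝ) 1, bias c x ^ k / A (bias c x) ∈ Set.Ioo (0 : ℝ) 1 := by
    intro x hx
    have hy := bias_mem c hx
    set y := bias c x
    have hpow := fun n => pow_pos hy.1 n
    obtain ⟨m, hmk, hm⟩ := hnonzero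
    have hlt : y ^ k < A y := by
      refine hasSum_lt (i := m) (fun n => ?_) ?_ (hasSum_ite_eq k (y ^ k)) (hA y hy)
      · by_cases hn : n = k
        · simp [hn, hak]
        · have := hpow n
          simp only [hn, if_false]
          positivity
      · have := hpow m
        have := hpos m
        simp only [hmk, if_false]
        positivity
    exact ⟨div_pos (hpow k) ((hpow k).trans hlt), (div_lt_one ((hpow k).trans hlt)).2 hlt⟩
  refine ⟨hrange, _, geometricMachine_stronglyRealizes c true hnum hden hout hpos hle
    (fun _ => ⟨k, hk⟩) (r := fun x => bias c x ^ k / A (bias c x))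
    (fun p hp => Set.Ioo_subset_Icc_self (hrange p hp)) (fun p hp => rfl) fun p hp => ?_⟩
  have hy := bias_mem c hp
  have hr := hrange p hp
  set y := bias c p
  have hy1 : 0 < 1 - y := sub_pos.2 hy.2
  have hA0 : A y ≠ 0 := by
    intro h
    simp [h] at hr
  set r := y ^ k / A y
  -- Since `a k = 1`, the count value is `[n = k] + r - r * a n`. For `r = y ^ k / A y` the first
  -- and last sums cancel, leaving `r / (1 - y)`.
  have hsum : HasSum (fun n => countValue (fun n => (num n / den n : ℝ))
      (fun n => decide (n = k)) r n * y ^ n) (y ^ k + r * (1 - y)⁻¹ - r * A y) := by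
    refine (((hasSum_ite_eq k (y ^ k)).add ((hasSum_geometric_of_lt_one hy.1.le hy.2).mul_left
      r)).sub ((hA y hy).mul_left r)).congr_fun ?_
    intro n
    by_cases hn : n = k
    · subst hn
      simp only [countValue, hak, decide_true, if_true]
      ring
    · simp only [countValue, hn, decide_false, if_false, Bool.false_eq_true]
      ring
  simp only [tailValue, Nat.zero_add]
  rw [hsum.tsum_eq]
  simp only [r]
  field_simp
  ring

end Geometric

/-! ### Zigzag numbers: computability, bounds and recursion -/

lemma primrec_factorial : Primrec Nat.factorial :=
  (Primrec.nat_rec₁ 1 (Primrec.nat_mul.comp₂ (Primrec.succ.comp₂ .left) .right)).of_eq fun n => by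
    induction n with
    | zero => rfl
    | succ n ih => rw [Nat.factorial_succ, ← ih]

lemma primrec_two_pow : Primrec fun n : ℕ => 2 ^ n :=
  (Primrec.nat_rec₁ 1 (Primrec.nat_mul.comp₂ .right (.const 2))).of_eq fun n => by
    induction n with
    | zero => rfl
    | succ n ih => rw [pow_succ, ← ih]

/-- The sequence for which `zigzag n / 2 ^ n` is the number of alternating permutations of `n`
elements. -/
def zigzag : ℕ → ℕ
  | 0 => 1
  -- Truncated subtraction makes `1 - n` the indicator of `n = 0`, the constant term in 2f' = 1 +
  -- f². The scaling by `2 ^ n` absorbs the 2 and avoids division.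
  | n + 1 => 1 - n + ∑ i : Fin (n + 1), n.choose i * zigzag i * zigzag (n - i)

lemma zigzag_succ (n : ℕ) :
    zigzag (n + 1) = 1 - n + ∑ i ∈ Finset.range (n + 1), n.choose i * zigzag i * zigzag (n - i) := by
  rw [zigzag, Finset.sum_range fun i => n.choose i * zigzag i * zigzag (n - i)]

/-- The recursion of `zigzag`, on the list of the earlier values. -/
def zigzagStep (l : List ℕ) : ℕ :=
  if l.length = 0 then 1
  else 1 - (l.length - 1) + (List.range l.length).foldl (fun s i => s +
    (l.length - 1).factorial / (i.factorial * (l.length - 1 - i).factorial) * l.getD i 0 *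
      l.getD (l.length - 1 - i) 0) 0

lemma foldl_add_eq_sum (f : ℕ → ℕ) (n : ℕ) :
    (List.range n).foldl (fun s i => s + f i) 0 = ∑ i ∈ Finset.range n, f i := by
  induction n with
  | zero => rfl
  | succ n ih => rw [List.range_succ, List.foldl_append, ih, Finset.sum_range_succ]; rfl

lemma zigzagStep_map (n : ℕ) : zigzagStep ((List.range n).map zigzag) = zigzag n := by
  cases n with
  | zero => simp [zigzagStep, zigzag]
  | succ n =>
    rw [zigzag_succ, zigzagStep]
    simp only [List.length_map, List.length_range, Nat.succ_ne_zero, if_false, Nat.add_sub_cancel]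
    rw [foldl_add_eq_sum fun i => n.factorial / (i.factorial * (n - i).factorial) *
      ((List.range (n + 1)).map zigzag).getD i 0 *
        ((List.range (n + 1)).map zigzag).getD (n - i) 0]
    congr 1
    refine Finset.sum_congr rfl fun i hi => ?_
    have hi' : i < n + 1 := Finset.mem_range.1 hi
    have hget : ∀ j < n + 1, ((List.range (n + 1)).map zigzag).getD j 0 = zigzag j := by
      intro j hj
      simp [List.getD_eq_getElem?_getD, hj]
    rw [hget i hi', hget (n - i) (by omega), Nat.choose_eq_factorial_div_factorial (by omega)]

lemma primrec_zigzagStep : Primrec zigzagStep := by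
  have hlen : Primrec fun l : List ℕ => l.length - 1 :=
    Primrec.nat_sub.comp .list_length (.const 1)
  have hl : Primrec fun x : List ℕ × (ℕ × ℕ) => x.1 := .fst
  have hi : Primrec fun x : List ℕ × (ℕ × ℕ) => x.2.2 := Primrec.snd.comp .snd
  have hni : Primrec fun x : List ℕ × (ℕ × ℕ) => x.1.length - 1 - x.2.2 :=
    Primrec.nat_sub.comp (hlen.comp hl) hi
  refine Primrec.ite (Primrec.eq.comp .list_length (.const 0)) (.const 1)
    (Primrec.nat_add.comp (Primrec.nat_sub.comp (.const 1) hlen)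
      (Primrec.list_foldl (h := fun l x => x.1 + (l.length - 1).factorial /
        (x.2.factorial * (l.length - 1 - x.2).factorial) * l.getD x.2 0 *
          l.getD (l.length - 1 - x.2) 0)
        (Primrec.list_range.comp .list_length) (.const 0) (Primrec₂.mk ?_)))
  refine Primrec.nat_add.comp (Primrec.fst.comp .snd) (Primrec.nat_mul.comp (Primrec.nat_mul.comp
    (Primrec.nat_div.comp ?_ (Primrec.nat_mul.comp ?_ ?_)) ?_) ?_)
  · exact primrec_factorial.comp (hlen.comp hl)
  · exact primrec_factorial.comp hi
  · exact primrec_factorial.comp hni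
  · exact (Primrec.list_getD 0).comp hl hi
  · exact (Primrec.list_getD 0).comp hl hni

/-- Course-of-values recursion, with `zigzagStep` computing each value from the list of earlier
ones. -/
lemma primrec_zigzag : Primrec zigzag :=
  (Primrec.nat_strong_rec (fun (_ : Unit) n => zigzag n)
    (g := fun _ l => some (zigzagStep l))
    (Primrec.option_some.comp (primrec_zigzagStep.comp .snd)).to₂
    fun _ n => congrArg some (zigzagStep_map n)).comp (.const ()) .id

/-- The binomial coefficient cancels the factorials, so each of the `n + 1` terms is at most `2 ^ n
* n.factorial`; the new factor 2 leaves room for the extra 1. -/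
lemma zigzag_le (n : ℕ) : zigzag n ≤ 2 ^ n * n.factorial := by
  induction n using Nat.strong_induction_on with
  | _ n ih =>
    cases n with
    | zero => simp [zigzag]
    | succ n =>
      have hterm : ∀ i ∈ Finset.range (n + 1), n.choose i * zigzag i * zigzag (n - i) ≤
          2 ^ n * n.factorial := by
        intro i hi
        have hi' : i ≤ n := Nat.lt_succ_iff.1 (Finset.mem_range.1 hi)
        calc n.choose i * zigzag i * zigzag (n - i)
            ≤ n.choose i * (2 ^ i * i.factorial) * (2 ^ (n - i) * (n - i).factorial) := by
              gcongr
              · exact ih i (by omega)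
              · exact ih (n - i) (by omega)
          _ = 2 ^ (i + (n - i)) * (n.choose i * i.factorial * (n - i).factorial) := by
              rw [pow_add]; ring
          _ = 2 ^ n * n.factorial := by
              rw [Nat.choose_mul_factorial_mul_factorial hi', Nat.add_sub_cancel' hi']
      have hsum := Finset.sum_le_card_nsmul _ _ _ hterm
      rw [Finset.card_range, smul_eq_mul] at hsum
      rw [zigzag_succ, Nat.factorial_succ, pow_succ]
      have hpos : 1 ≤ (n + 1) * (2 ^ n * n.factorial) := Nat.succ_le_of_lt (by positivity)
      calc 1 - n + ∑ i ∈ Finset.range (n + 1), n.choose i * zigzag i * zigzag (n - i)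
          ≤ (n + 1) * (2 ^ n * n.factorial) + (n + 1) * (2 ^ n * n.factorial) := by
            gcongr; omega
        _ = 2 ^ n * 2 * ((n + 1) * n.factorial) := by ring

/-- The Taylor coefficients of `tan (x / 2 + π / 4) = 1 / cos x + tan x`. -/
noncomputable def zigzagCoeff (n : ℕ) : ℝ := zigzag n / (2 ^ n * n.factorial : ℕ)

lemma zigzagCoeff_nonneg (n : ℕ) : 0 ≤ zigzagCoeff n := by unfold zigzagCoeff; positivity

lemma zigzagCoeff_le_one (n : ℕ) : zigzagCoeff n ≤ 1 :=
  div_le_one_of_le₀ (by exact_mod_cast zigzag_le n) (by positivity)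

/-- The coefficient of `x ^ n` in 2f' = 1 + f². -/
lemma zigzagCoeff_succ (n : ℕ) :
    2 * ((n + 1) * zigzagCoeff (n + 1)) =
      (if n = 0 then 1 else 0) +
        ∑ i ∈ Finset.range (n + 1), zigzagCoeff i * zigzagCoeff (n - i) := by
  have hterm : ∀ i ∈ Finset.range (n + 1), zigzagCoeff i * zigzagCoeff (n - i) =
      (n.choose i * zigzag i * zigzag (n - i) : ℕ) / (2 ^ n * n.factorial : ℕ) := by
    intro i hi
    have hi' : i ≤ n := Nat.lt_succ_iff.1 (Finset.mem_range.1 hi)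
    have hpow : (2 : ℝ) ^ n = 2 ^ i * 2 ^ (n - i) := by rw [← pow_add, Nat.add_sub_cancel' hi']
    have hc : (n.factorial : ℝ) = n.choose i * i.factorial * (n - i).factorial := by
      exact_mod_cast (Nat.choose_mul_factorial_mul_factorial hi').symm
    have hchoose : (n.choose i : ℝ) ≠ 0 := by exact_mod_cast (Nat.choose_pos hi').ne'
    have h1 : (i.factorial : ℝ) ≠ 0 := by positivity
    have h2 : ((n - i).factorial : ℝ) ≠ 0 := by positivity
    unfold zigzagCoeff
    push_cast
    rw [hpow, hc]
    field_simp
  rw [Finset.sum_congr rfl hterm, ← Finset.sum_div, ← Nat.cast_sum]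
  unfold zigzagCoeff
  rw [zigzag_succ, Nat.factorial_succ, pow_succ]
  have h1 : (n.factorial : ℝ) ≠ 0 := by positivity
  have h2 : (n + 1 : ℝ) ≠ 0 := by positivity
  rcases Nat.eq_zero_or_pos n with rfl | hn
  · norm_num
    ring
  · rw [Nat.sub_eq_zero_of_le hn, if_neg hn.ne']
    push_cast
    field_simp
    ring

/-! ### Identification of the zigzag series with secant plus tangent -/

/-- The generating function of the zigzag numbers. -/
noncomputable def zigzagSeries (x : ℝ) : ℝ := ∑' n, zigzagCoeff n * x ^ n

lemma summable_norm_zigzagCoeff {x : ℝ} (hx : |x| < 1) :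
    Summable fun n => ‖zigzagCoeff n * x ^ n‖ := by
  refine (summable_geometric_of_lt_one (abs_nonneg x) hx).of_nonneg_of_le
    (fun n => norm_nonneg _) fun n => ?_
  rw [norm_mul, norm_pow, Real.norm_eq_abs, Real.norm_eq_abs, abs_of_nonneg (zigzagCoeff_nonneg n)]
  exact mul_le_of_le_one_left (by positivity) (zigzagCoeff_le_one n)

lemma hasSum_zigzagSeries {x : ℝ} (hx : |x| < 1) :
    HasSum (fun n => zigzagCoeff n * x ^ n) (zigzagSeries x) :=
  (summable_norm_zigzagCoeff hx).of_norm.hasSum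

lemma hasSum_zigzagSeries_sq {x : ℝ} (hx : |x| < 1) :
    HasSum (fun n => (∑ i ∈ Finset.range (n + 1), zigzagCoeff i * zigzagCoeff (n - i)) * x ^ n)
      (zigzagSeries x ^ 2) := by
  have hs := summable_norm_zigzagCoeff hx
  have h := hasSum_sum_range_mul_of_summable_norm hs hs
  rw [← zigzagSeries, ← sq] at h
  refine h.congr_fun fun n => ?_
  rw [Finset.sum_mul]
  refine Finset.sum_congr rfl fun i hi => ?_
  have hi' : i ≤ n := Nat.lt_succ_iff.1 (Finset.mem_range.1 hi)
  conv_lhs => rw [← Nat.add_sub_cancel' hi', pow_add]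
  simp only [Nat.add_sub_cancel' hi']
  ring

lemma hasDerivAt_zigzagSeries {x : ℝ} (hx : |x| < 1) :
    HasDerivAt zigzagSeries ((1 + zigzagSeries x ^ 2) / 2) x := by
  -- On the ball of radius `r < 1` the differentiated terms are dominated by the summable `n * r ^
  -- (n - 1)`.
  obtain ⟨r, hxr, hr⟩ := exists_between hx
  have hr0 : 0 ≤ r := (abs_nonneg x).trans hxr.le
  have hu : Summable fun n : ℕ => (n : ℝ) * r ^ (n - 1) := by
    rw [← summable_nat_add_iff 1]
    have h1 := summable_pow_mul_geometric_of_norm_lt_one 1 (r := r)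
      (by rwa [Real.norm_of_nonneg hr0])
    have h2 := summable_geometric_of_lt_one hr0 hr
    refine (h1.add h2).congr fun n => ?_
    simp only [Nat.add_sub_cancel]
    push_cast
    ring
  have hmem : ∀ {y : ℝ}, y ∈ Metric.ball (0 : ℝ) r ↔ |y| < r := fun {y} => by
    rw [mem_ball_zero_iff, Real.norm_eq_abs]
  have hder := hasDerivAt_tsum_of_isPreconnected (g := fun n y => zigzagCoeff n * y ^ n)
    (g' := fun n y => zigzagCoeff n * (n * y ^ (n - 1))) (t := Metric.ball (0 : ℝ) r) (y₀ := x)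
    (y := x) hu Metric.isOpen_ball (convex_ball 0 r).isPreconnected
    (fun n y _ => (hasDerivAt_pow n y).const_mul _) (fun n y hy => ?_) (hmem.2 hxr)
    (summable_norm_zigzagCoeff hx).of_norm (hmem.2 hxr)
  · have hval : HasSum (fun n : ℕ => zigzagCoeff n * (n * x ^ (n - 1)))
        ((1 + zigzagSeries x ^ 2) / 2) := by
      rw [← hasSum_nat_add_iff' 1]
      simp only [Finset.sum_range_one, Nat.cast_zero, zero_mul, mul_zero, sub_zero]
      refine (((hasSum_ite_eq 0 (1 : ℝ)).add (hasSum_zigzagSeries_sq hx)).div_const 2).congr_fun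
        fun n => ?_
      have hrec := zigzagCoeff_succ n
      have : (if n = 0 then (1 : ℝ) else 0) = (if n = 0 then 1 else 0) * x ^ n := by
        split_ifs with h <;> simp [h]
      rw [this, ← add_mul, ← hrec, Nat.add_sub_cancel]
      push_cast
      ring
    rwa [hval.tsum_eq] at hder
  · rw [Real.norm_eq_abs, abs_mul, abs_mul, abs_pow, abs_of_nonneg (zigzagCoeff_nonneg n),
      Nat.abs_cast]
    refine (mul_le_of_le_one_left (by positivity) (zigzagCoeff_le_one n)).trans ?_
    have := (hmem.1 hy).le
    gcongr

lemma zigzagSeries_zero : zigzagSeries 0 = 1 := by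
  rw [zigzagSeries, tsum_eq_single 0 fun n hn => by simp [hn]]
  simp [zigzagCoeff, zigzag]

/-- By the differential equation, `arctan f - x / 2` has zero derivative, so it keeps its value `π /
4` at 0. -/
lemma zigzagSeries_eq_tan {x : ℝ} (hx : |x| < 1) :
    zigzagSeries x = Real.tan (x / 2 + Real.pi / 4) := by
  have hmem : ∀ {y : ℝ}, y ∈ Metric.ball (0 : ℝ) 1 ↔ |y| < 1 := fun {y} => by
    rw [mem_ball_zero_iff, Real.norm_eq_abs]
  have hder : ∀ y ∈ Metric.ball (0 : ℝ) 1,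
      HasDerivAt (fun y => Real.arctan (zigzagSeries y) - y / 2) 0 y := by
    intro y hy
    have h := (hasDerivAt_zigzagSeries (hmem.1 hy)).arctan.sub ((hasDerivAt_id y).div_const 2)
    have hne : 1 + zigzagSeries y ^ 2 ≠ 0 := by positivity
    refine h.congr_deriv ?_
    field_simp
    ring
  have hconst := Metric.isOpen_ball.is_const_of_deriv_eq_zero (convex_ball (0 : ℝ) 1).isPreconnected
    (fun y hy => (hder y hy).differentiableAt.differentiableWithinAt)
    (fun y hy => (hder y hy).deriv) (hmem.2 hx) (Metric.mem_ball_self one_pos)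
  simp only [zigzagSeries_zero, Real.arctan_one, zero_div, sub_zero] at hconst
  rw [← Real.tan_arctan (zigzagSeries x)]
  congr 1
  linarith

/-- With `u = x / 2 + π / 4`, the values at `x` and `-x` are `tan u` and `cot u`, while `cos x = sin
2u` and `sin x = -cos 2u`. -/
lemma zigzagSeries_add_neg {x : ℝ} (hx : x ∈ Set.Ioo (0 : ℝ) 1) :
    (zigzagSeries x + zigzagSeries (-x)) / 2 = 1 / Real.cos x ∧
      (zigzagSeries x - zigzagSeries (-x)) / 2 = Real.tan x := by
  have habs : |x| < 1 := abs_lt.2 ⟨by linarith [hx.1], hx.2⟩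
  have hpi := Real.pi_gt_three
  obtain ⟨u, hu⟩ : ∃ u, u = x / 2 + Real.pi / 4 := ⟨_, rfl⟩
  have hx2 : x = 2 * u - Real.pi / 2 := by rw [hu]; ring
  have hs : Real.sin u ≠ 0 := (Real.sin_pos_of_pos_of_lt_pi
    (by rw [hu]; linarith [hx.1]) (by rw [hu]; linarith [hx.2])).ne'
  have hc : Real.cos u ≠ 0 := (Real.cos_pos_of_mem_Ioo
    ⟨by rw [hu]; linarith [hx.1], by rw [hu]; linarith [hx.2]⟩).ne'
  have hcos : Real.cos x = 2 * Real.sin u * Real.cos u := by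
    rw [hx2, Real.cos_sub_pi_div_two, Real.sin_two_mul]
  have hsin : Real.sin x = Real.sin u ^ 2 - Real.cos u ^ 2 := by
    rw [hx2, Real.sin_sub_pi_div_two, Real.cos_two_mul, Real.sin_sq]; ring
  have hneg : -x / 2 + Real.pi / 4 = Real.pi / 2 - u := by rw [hu]; ring
  rw [zigzagSeries_eq_tan habs, zigzagSeries_eq_tan (by rwa [abs_neg]), hneg, ← hu,
    Real.tan_pi_div_two_sub, Real.tan_eq_sin_div_cos, Real.tan_eq_sin_div_cos x, hcos, hsin]
  constructor
  · field_simp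
    rw [Real.sin_sq_add_cos_sq]
  · field_simp

lemma hasSum_one_div_cos {x : ℝ} (hx : x ∈ Set.Ioo (0 : ℝ) 1) :
    HasSum (fun n => ((zigzag n * (1 - n % 2) : ℕ) / (2 ^ n * n.factorial : ℕ) : ℝ) * x ^ n)
      (1 / Real.cos x) := by
  have habs : |x| < 1 := abs_lt.2 ⟨by linarith [hx.1], hx.2⟩
  rw [← (zigzagSeries_add_neg hx).1]
  refine (((hasSum_zigzagSeries habs).add (hasSum_zigzagSeries
    (x := -x) (by rwa [abs_neg]))).div_const 2).congr_fun fun n => ?_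
  unfold zigzagCoeff
  rcases Nat.even_or_odd n with h | h
  · rw [h.neg_pow, Nat.even_iff.1 h]
    push_cast
    ring
  · rw [h.neg_pow, Nat.odd_iff.1 h]
    push_cast
    ring

lemma hasSum_tan {x : ℝ} (hx : x ∈ Set.Ioo (0 : ℝ) 1) :
    HasSum (fun n => ((zigzag n * (n % 2) : ℕ) / (2 ^ n * n.factorial : ℕ) : ℝ) * x ^ n)
      (Real.tan x) := by
  have habs : |x| < 1 := abs_lt.2 ⟨by linarith [hx.1], hx.2⟩
  rw [← (zigzagSeries_add_neg hx).2]
  refine (((hasSum_zigzagSeries habs).sub (hasSum_zigzagSeries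
    (x := -x) (by rwa [abs_neg]))).div_const 2).congr_fun fun n => ?_
  unfold zigzagCoeff
  rcases Nat.even_or_odd n with h | h
  · rw [h.neg_pow, Nat.even_iff.1 h]
    push_cast
    ring
  · rw [h.neg_pow, Nat.odd_iff.1 h]
    push_cast
    ring

/-! ### Power series and the resulting simulations -/

lemma hasSum_exp {x : ℝ} :
    HasSum (fun n => ((1 : ℕ) / (n.factorial : ℕ) : ℝ) * x ^ n) (Real.exp x) := by
  rw [Real.exp_eq_exp_ℝ]
  refine (NormedSpace.expSeries_div_hasSum_exp x).congr_fun fun n => ?_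
  push_cast
  ring

/-- Truncated subtraction encodes the coefficients 0 at `n = 0` and `1 / n` otherwise, with a
denominator that is always positive. -/
lemma hasSum_log {x : ℝ} (hx : x ∈ Set.Ioo (0 : ℝ) 1) :
    HasSum (fun n => ((1 - (1 - n) : ℕ) / (n - 1 + 1 : ℕ) : ℝ) * x ^ n)
      (Real.log (1 / (1 - x))) := by
  have habs : |x| < 1 := abs_lt.2 ⟨by linarith [hx.1], hx.2⟩
  rw [one_div, Real.log_inv, ← hasSum_nat_add_iff' 1]
  simp only [Finset.sum_range_one, Nat.sub_zero, Nat.sub_self, Nat.cast_zero, zero_div, zero_mul,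
    sub_zero]
  refine (Real.hasSum_pow_div_log_of_abs_lt_one habs).congr_fun fun n => ?_
  simp
  ring

lemma computable_two_pow_mul_factorial : Computable fun n : ℕ => 2 ^ n * n.factorial :=
  (Primrec.nat_mul.comp primrec_two_pow primrec_factorial).to_comp

lemma primrec_mod_two : Primrec fun n : ℕ => n % 2 :=
  Primrec.nat_mod.comp .id (.const 2)

theorem stronglyRealizable_one_sub_mul_exp (c : Bool) :
    StronglyRealizable fun x => (1 - bias c x) * Real.exp (bias c x) :=
  stronglyRealizable_one_sub_mul c (.const 1) primrec_factorial.to_comp Nat.factorial_pos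
    -- The coefficients at 0 and 1 both equal 1, so index 2 is the first strictly below 1.
    Nat.factorial_pos ⟨0, one_pos⟩ ⟨2, by decide⟩ fun _ _ => hasSum_exp

theorem stronglyRealizable_exp_neg (c : Bool) :
    StronglyRealizable fun x => bias c x ^ 0 / Real.exp (bias c x) :=
  stronglyRealizable_pow_div c 0 (.const 1) primrec_factorial.to_comp Nat.factorial_pos
    Nat.factorial_pos rfl ⟨1, one_ne_zero, one_pos⟩ fun _ _ => hasSum_exp

lemma computable_sign : Computable fun n : ℕ => 1 - (1 - n) :=
  (Primrec.nat_sub.comp (.const 1) (Primrec.nat_sub.comp (.const 1) .id)).to_comp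

lemma computable_pred_succ : Computable fun n : ℕ => n - 1 + 1 :=
  (Primrec.succ.comp Primrec.pred).to_comp

theorem stronglyRealizable_one_sub_mul_log (c : Bool) :
    StronglyRealizable fun x => (1 - bias c x) * Real.log (1 / (1 - bias c x)) :=
  stronglyRealizable_one_sub_mul (A := fun y => Real.log (1 / (1 - y))) c computable_sign
    computable_pred_succ (fun n => Nat.succ_pos _) (fun n => by omega) ⟨1, one_pos⟩ ⟨0, one_pos⟩
    fun _ => hasSum_log

theorem stronglyRealizable_div_log (c : Bool) :
    StronglyRealizable fun x => bias c x ^ 1 / Real.log (1 / (1 - bias c x)) :=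
  stronglyRealizable_pow_div (A := fun y => Real.log (1 / (1 - y))) c 1 computable_sign
    computable_pred_succ (fun n => Nat.succ_pos _) (fun n => by omega) rfl
    ⟨2, by decide, one_pos⟩ fun _ => hasSum_log

lemma computable_zigzag_even : Computable fun n => zigzag n * (1 - n % 2) :=
  (Primrec.nat_mul.comp primrec_zigzag
    (Primrec.nat_sub.comp (.const 1) primrec_mod_two)).to_comp

lemma computable_zigzag_odd : Computable fun n => zigzag n * (n % 2) :=
  (Primrec.nat_mul.comp primrec_zigzag primrec_mod_two).to_comp

lemma zigzag_mul_le {k : ℕ} (hk : k ≤ 1) (n : ℕ) : zigzag n * k ≤ 2 ^ n * n.factorial :=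
  (Nat.mul_le_mul_left _ hk).trans (by simpa using zigzag_le n)

lemma zigzag_pos (n : ℕ) : 0 < zigzag n := by
  induction n using Nat.strong_induction_on with
  | _ n ih =>
    cases n with
    | zero => simp [zigzag]
    | succ n =>
      rw [zigzag_succ]
      refine Nat.add_pos_right _ (Finset.sum_pos (fun i hi => ?_) ⟨0, by simp⟩)
      have hi' : i ≤ n := Nat.lt_succ_iff.1 (Finset.mem_range.1 hi)
      exact Nat.mul_pos (Nat.mul_pos (Nat.choose_pos hi') (ih i (by omega))) (ih (n - i) (by omega))

lemma zigzag_zero : zigzag 0 = 1 := by rw [zigzag]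

lemma zigzag_one : zigzag 1 = 2 := by simp [zigzag_succ, zigzag_zero]

theorem stronglyRealizable_one_sub_mul_sec :
    StronglyRealizable fun x => (1 - bias true x) * (1 / Real.cos (bias true x)) :=
  stronglyRealizable_one_sub_mul (A := fun y => 1 / Real.cos y) true computable_zigzag_even
    computable_two_pow_mul_factorial (fun n => by positivity) (fun n => zigzag_mul_le (by omega) n)
    ⟨0, by simp [zigzag_zero]⟩ ⟨1, by simp⟩ fun _ => hasSum_one_div_cos

theorem stronglyRealizable_inv_sec :
    StronglyRealizable fun x => bias true x ^ 0 / (1 / Real.cos (bias true x)) :=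
  stronglyRealizable_pow_div (A := fun y => 1 / Real.cos y) true 0 computable_zigzag_even
    computable_two_pow_mul_factorial (fun n => by positivity) (fun n => zigzag_mul_le (by omega) n)
    (by simp [zigzag_zero]) ⟨2, by decide, by simpa using zigzag_pos 2⟩ fun _ => hasSum_one_div_cos

theorem stronglyRealizable_one_sub_mul_tan :
    StronglyRealizable fun x => (1 - bias true x) * Real.tan (bias true x) :=
  stronglyRealizable_one_sub_mul true computable_zigzag_odd
    computable_two_pow_mul_factorial (fun n => by positivity) (fun n => zigzag_mul_le (by omega) n)
    ⟨1, by simp [zigzag_one]⟩ ⟨0, by simp⟩ fun _ => hasSum_tan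

theorem stronglyRealizable_div_tan :
    StronglyRealizable fun x => bias true x ^ 1 / Real.tan (bias true x) :=
  stronglyRealizable_pow_div true 1 computable_zigzag_odd
    computable_two_pow_mul_factorial (fun n => by positivity) (fun n => zigzag_mul_le (by omega) n)
    (by simp [zigzag_one]) ⟨3, by decide, by simpa using zigzag_pos 3⟩ fun _ => hasSum_tan

theorem theorem4 :
    StronglyRealizable (fun x => Real.exp (-x)) ∧
    StronglyRealizable (fun x => Real.exp (x - 1)) ∧
    StronglyRealizable (fun x => (1 - x) * Real.exp x) ∧
    StronglyRealizable (fun x => x * Real.exp (1 - x)) ∧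
    StronglyRealizable (fun x => x / Real.log (1 / (1 - x))) ∧
    StronglyRealizable (fun x => (1 - x) / Real.log (1 / x)) ∧
    StronglyRealizable (fun x => (1 - x) * Real.log (1 / (1 - x))) ∧
    StronglyRealizable (fun x => x * Real.log (1 / x)) ∧
    StronglyRealizable (fun x => Real.cos x) ∧
    StronglyRealizable (fun x => (1 - x) / Real.cos x) ∧
    StronglyRealizable (fun x => x / Real.tan x) ∧
    StronglyRealizable (fun x => (1 - x) * Real.tan x) := by
  have hfalse : ∀ x, bias false x = 1 - x := fun _ => rfl
  have htrue : ∀ x, bias true x = x := fun _ => rfl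
  refine ⟨?_, ?_, ?_, ?_, ?_, ?_, ?_, ?_, ?_, ?_, ?_, ?_⟩
  · simpa only [htrue, pow_zero, one_div, ← Real.exp_neg] using stronglyRealizable_exp_neg true
  · simpa only [hfalse, pow_zero, one_div, ← Real.exp_neg, neg_sub] using
      stronglyRealizable_exp_neg false
  · exact stronglyRealizable_one_sub_mul_exp true
  · simpa only [hfalse, sub_sub_cancel] using stronglyRealizable_one_sub_mul_exp false
  · simpa only [htrue, pow_one] using stronglyRealizable_div_log true
  · simpa only [hfalse, pow_one, sub_sub_cancel] using stronglyRealizable_div_log false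
  · exact stronglyRealizable_one_sub_mul_log true
  · simpa only [hfalse, sub_sub_cancel] using stronglyRealizable_one_sub_mul_log false
  · simpa only [htrue, pow_zero, one_div_one_div] using stronglyRealizable_inv_sec
  · simpa only [htrue, mul_one_div] using stronglyRealizable_one_sub_mul_sec
  · simpa only [htrue, pow_one] using stronglyRealizable_div_tan
  · exact stronglyRealizable_one_sub_mul_tan
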